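/- Let $H$ be an infinite-dimensional real separable Hilbert space, and let $\mathcal K$ be the space of compact operators on $H$, endowed with the operator norm $\|\cdot\|_\infty$. For $u,v\in H$ write $(u\otimes v)(h)=\langle u,h\rangle v$. Let $(X_n)_{n\in\mathbb Z}$ be a strictly stationary centered $H$-valued autoregressive process of order one, $$X_n=\rho(X_{n-1})+\varepsilon_n,\qquad n\in\mathbb Z,$$ where $\rho\in\mathcal K$ with $\|\rho\|_\infty<1$, the $\varepsilon_n$ are i.i.d. centered random elements of $H$ with $\mathbb E\|\varepsilon_0\|^2<\infty$, and $\varepsilon_n$ is independent of $X_{n-1}$ for every $n$. Suppose that the covariance operator $\Gamma=\mathbb E(X_1\otimes X_1)$ satisfies $\ker\Gamma=\{0\}$. From the sample $(X_1,\dots,X_n)$ form $$\Gamma_n=\frac1n\sum_{k=1}^nX_k\otimes X_k,\qquad \Delta_n=\frac1{n-1}\sum_{k=1}^{n-1}X_k\otimes X_{k+1}.$$ Let $\Gamma_n=\sum_{l\ge1}\widehat\lambda_l\,\widehat e_l\otimes\widehat e_l$ be a spectral decomposition of $\Gamma_n$ with $\widehat\lambda_1\ge\widehat\lambda_2\ge\dots\ge0$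 and $(\widehat e_l)_{l\ge1}$ orthonormal, let $(k_n)$ be a sequence of positive integers with $k_n\to\infty$, and let $$\Gamma_n^\dagger=\sum_{l\le k_n}\widehat\lambda_l^{-1}\,\widehat e_l\otimes\widehat e_l,\qquad \widehat\rho_n=\Delta_n\Gamma_n^\dagger ,$$ where the terms with $\widehat\lambda_l=0$ are omitted from the sum. Then $\widehat\rho_n-\rho$ has no nonzero limit in distribution for the norm topology of $\mathcal K$, under any normalization: for every real sequence $\alpha_n\to+\infty$, the sequence $\alpha_n(\widehat\rho_n-\rho)$ of random elements of $\mathcal K$ either does not converge in distribution in $(\mathcal K,\|\cdot\|_\infty)$, or converges in distribution to the Dirac mass at the null operator. -/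

import Mathlib

open MeasureTheory ProbabilityTheory Filter Topology

noncomputable section

namespace FAR

variable {H : Type*} [NormedAddCommGroup H] [InnerProductSpace ℝ H]

variable (H) in
/-- The space `𝒦(H)` of compact operators on `H`, a subspace of the bounded operators: it carries
the operator norm, and the Borel σ-algebra of the operator-norm topology. -/
abbrev Compacts : Submodule ℝ (H →L[ℝ] H) := compactOperator (RingHom.id ℝ) H H

/-- The tensor product `u ⊗ v`, i.e. the operator `h ↦ ⟪u, h⟫ v`. -/
def tensor (u v : H) : H →L[ℝ] H := InnerProductSpace.rankOne ℝ v u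

theorem tensor_apply (u v h : H) : tensor u v h = inner ℝ u h • v := by
  simp [tensor]

theorem isCompactOperator_tensor (u v : H) : IsCompactOperator (tensor u v) := by
  have h : tensor u v
      = (ContinuousLinearMap.toSpanSingleton ℝ v).comp (innerSL ℝ u) := by
    ext h
    simp [tensor_apply]
  rw [h]
  exact (isCompactOperator_of_locallyCompactSpace_rng
    (ContinuousLinearMap.toSpanSingleton ℝ v)).comp_clm _

section Model

variable {Ω : Type*} [MeasurableSpace Ω] [MeasurableSpace H] [BorelSpace H]

/-- `(X_n)` is the (centered) functional autoregressive process of order 1 with autocorrelation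
operator `ρ` and innovations `(ε_n)`: the innovations are i.i.d. and centered, the process is
strictly stationary, `ε_n` is independent of `X_{n-1}`, and `X_n = ρ X_{n-1} + ε_n` a.s. -/
structure IsFAR1 (P : Measure Ω) (ρ : H →L[ℝ] H) (X ε : ℤ → Ω → H) : Prop where
  measurable_process : ∀ n, Measurable (X n)
  measurable_noise : ∀ n, Measurable (ε n)
  iIndep_noise : iIndepFun ε P
  identDistrib_noise : ∀ n, IdentDistrib (ε n) (ε 0) P P
  integral_noise : ∫ ω, ε 0 ω ∂P = 0
  stationary : ∀ k : ℤ, IdentDistrib (fun ω n => X (n + k) ω) (fun ω n => X n ω) P P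
  indep_past : ∀ n, IndepFun (ε n) (X (n - 1)) P
  recursion : ∀ n, ∀ᵐ ω ∂P, X n ω = ρ (X (n - 1) ω) + ε n ω

/-- The covariance operator `Γ = 𝔼 (X₁ ⊗ X₁)`. -/
def covOp (P : Measure Ω) (X : ℤ → Ω → H) : H →L[ℝ] H :=
  ∫ ω, tensor (X 1 ω) (X 1 ω) ∂P

end Model

/-- The empirical covariance operator `Γ_n = (1/n) ∑_{k=1}^n X_k ⊗ X_k` of a trajectory. -/
def empCov (x : ℤ → H) (n : ℕ) : H →L[ℝ] H :=
  (n : ℝ)⁻¹ • ∑ k ∈ Finset.Icc 1 n, tensor (x k) (x k)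

/-- The empirical cross-covariance operator
`Δ_n = (1/(n-1)) ∑_{k=1}^{n-1} X_k ⊗ X_{k+1}` of a trajectory. -/
def empCross (x : ℤ → H) (n : ℕ) : H →L[ℝ] H :=
  ((n : ℝ) - 1)⁻¹ • ∑ k ∈ Finset.Ico 1 n, tensor (x k) (x (k + 1))

/-- `A = ∑_l λ_l e_l ⊗ e_l` is a spectral decomposition of `A` with orthonormal eigenvectors and
nonnegative eigenvalues in nonincreasing order (the indices start at `0`, and eigenvalues are
repeated according to their multiplicity). -/
structure IsSpectralDecomp (A : H →L[ℝ] H) (lam : ℕ → ℝ) (e : ℕ → H) : Prop where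
  orthonormal : Orthonormal ℝ e
  antitone : Antitone lam
  nonneg : ∀ l, 0 ≤ lam l
  hasSum : ∀ x, HasSum (fun l => lam l • tensor (e l) (e l) x) (A x)

/-- The regularized inverse `∑_{l ≤ k} λ_l⁻¹ e_l ⊗ e_l` built from the `k` largest eigenvalues.
A vanishing eigenvalue contributes `0` (pseudo-inverse). -/
def truncInv (lam : ℕ → ℝ) (e : ℕ → H) (k : ℕ) : H →L[ℝ] H :=
  ∑ l ∈ Finset.range k, (lam l)⁻¹ • tensor (e l) (e l)

/-- The estimate `ρ̂_n = Δ_n Γ_n†` of the autocorrelation operator, for the trajectory `x`, the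
truncation level `k` and the eigenelements `(lam, e)` of `Γ_n`. -/
def estimator (x : ℤ → H) (n k : ℕ) (lam : ℕ → ℝ) (e : ℕ → H) : H →L[ℝ] H :=
  (empCross x n).comp (truncInv lam e k)

theorem estimator_mem (x : ℤ → H) (n k : ℕ) (lam : ℕ → ℝ) (e : ℕ → H) :
    estimator x n k lam e ∈ Compacts H := by
  have h : empCross x n ∈ Compacts H :=
    Submodule.smul_mem _ _ (Submodule.sum_mem _ fun _ _ => isCompactOperator_tensor _ _)
  exact IsCompactOperator.comp_clm (f := empCross x n) h (truncInv lam e k)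

/-- The estimation error `ρ̂_n - ρ`, as an element of the space of compact operators. -/
def error (ρ : Compacts H) (x : ℤ → H) (n k : ℕ) (lam : ℕ → ℝ) (e : ℕ → H) : Compacts H :=
  ⟨estimator x n k lam e, estimator_mem x n k lam e⟩ - ρ

end FAR

end

/-! Write E_n = ρ̂_n - ρ and let S_n = (n-1)⁻¹ ∑ X_k ⊗ ε_{k+1} be the noise operator (`empNoise`).
The recursion gives Δ_n = ρ Γ_n + S_n plus a boundary term of order 1/n, and Γ_n† Γ_n Γ_n† = Γ_n†.
So E_n maps Γ_n Γ_n† Γ_n h to S_n (Γ_n† Γ_n h), up to the boundary term. Now Γ_n h is close to Γ h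
by the law of large numbers. Next, Γ_n Γ_n† Γ_n h is close to Γ_n h because the truncated eigenvalue
tends to 0, and Γ_n† Γ_n h is close to h because Γ has dense range. Hence E_n Γ h is S_n h up to
o(‖E_n‖) + o(‖S_n‖) + O(1/n) in probability (`norm_empNoise_sub_le`). The norm of Γ_n† never enters,
so neither a rate for k_n nor a spectral gap is needed.

Two facts about S_n are used. Orthogonality of martingale increments bounds √n ‖S_n‖ in probability,
through the Hilbert-Schmidt norm (`bddInProb_empNoise`). A martingale central limit theorem makes √n
⟪S_n x, f⟫ asymptotically centred Gaussian with variance ⟪Γ x, x⟫ when 𝔼⟪ε_0, f⟫² = 1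
(`tendsto_integral_cexp_empNoise`).

Let α_n E_n converge in distribution; it is then bounded in probability. If α_n ≥ c √n eventually,
the comparison bounds √n ‖S_n x‖ by a multiple of ‖Γ x‖ independent of x, whereas its fluctuations
have size √⟪Γ x, x⟫. In infinite dimension some x makes ‖Γ x‖ negligible against √⟪Γ x, x⟫
(`exists_norm_covOp_sq_le`), a contradiction (`not_eventually_mul_sqrt_le`). So for every c > 0, α_n
< c √n infinitely often. At such times α_n E_n Γ x, like α_n S_n x, is small in probability. The
portmanteau theorem transfers this to the limit T, giving T Γ x = 0 almost surely
(`measure_norm_apply_covOp_gt`), and the dense range of Γ forces T = 0 (`eq_dirac`). -/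

namespace FAR

/-- The empirical trace `(1/n) ∑_{k=1}^n ‖X_k‖²`. -/
noncomputable def empTrace {H : Type*} [NormedAddCommGroup H] (x : ℤ → H) (n : ℕ) : ℝ :=
  (n : ℝ)⁻¹ * ∑ k ∈ Finset.Icc 1 n, ‖x k‖ ^ 2

theorem empTrace_nonneg {H : Type*} [NormedAddCommGroup H] (x : ℤ → H) (n : ℕ) :
    0 ≤ empTrace x n := by
  unfold empTrace; positivity

/-! ### Spectral calculus for the truncated pseudo-inverse. -/

section Spectral

variable {H : Type*} [NormedAddCommGroup H] [InnerProductSpace ℝ H]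

theorem truncInv_apply (lam : ℕ → ℝ) (e : ℕ → H) (k : ℕ) (x : H) :
    truncInv lam e k x = ∑ l ∈ Finset.range k, ((lam l)⁻¹ * inner ℝ (e l) x) • e l := by
  simp [truncInv, tensor_apply, mul_smul]

theorem inner_truncInv {lam : ℕ → ℝ} {e : ℕ → H} (he : Orthonormal ℝ e) {k l : ℕ} (hl : l < k)
    (x : H) : inner ℝ (e l) (truncInv lam e k x) = (lam l)⁻¹ * inner ℝ (e l) x := by
  rw [truncInv_apply, he.inner_right_sum _ (Finset.mem_range.2 hl)]

/-- A combination of orthonormal vectors whose coefficients are dominated by the coordinates of a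
vector is bounded by the norm of that vector. -/
theorem norm_le_of_hasSum_orthonormal {e : ℕ → H} (he : Orthonormal ℝ e) {c : ℕ → ℝ} {C : ℝ}
    (hC : 0 ≤ C) {x z : H} (hc : ∀ l, |c l| ≤ C * |inner ℝ (e l) x|)
    (hz : HasSum (fun l => c l • e l) z) : ‖z‖ ≤ C * ‖x‖ := by
  refine le_of_tendsto hz.norm (Eventually.of_forall fun s => ?_)
  refine le_of_sq_le_sq ?_ (by positivity)
  have h1 : ‖∑ l ∈ s, c l • e l‖ ^ 2 = ∑ l ∈ s, c l ^ 2 := by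
    rw [← real_inner_self_eq_norm_sq, he.inner_sum]
    simp [pow_two]
  calc ‖∑ l ∈ s, c l • e l‖ ^ 2 = ∑ l ∈ s, c l ^ 2 := h1
    _ ≤ ∑ l ∈ s, C ^ 2 * ‖inner ℝ (e l) x‖ ^ 2 := by
        refine Finset.sum_le_sum fun l _ => ?_
        rw [← sq_abs, ← mul_pow]
        exact pow_le_pow_left₀ (abs_nonneg _) (hc l) 2
    _ ≤ C ^ 2 * ‖x‖ ^ 2 := by
        rw [← Finset.mul_sum]
        exact mul_le_mul_of_nonneg_left (he.sum_inner_products_le x) (by positivity)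
    _ = (C * ‖x‖) ^ 2 := by ring

namespace IsSpectralDecomp

variable {A : H →L[ℝ] H} {lam : ℕ → ℝ} {e : ℕ → H}

theorem hasSum_smul (h : IsSpectralDecomp A lam e) (x : H) :
    HasSum (fun l => (lam l * inner ℝ (e l) x) • e l) (A x) := by
  simpa [tensor_apply, mul_smul] using h.hasSum x

theorem inner_apply (h : IsSpectralDecomp A lam e) (l : ℕ) (x : H) :
    inner ℝ (e l) (A x) = lam l * inner ℝ (e l) x := by
  have h1 := (h.hasSum_smul x).mapL (innerSL ℝ (e l))
  have h2 : HasSum (fun m => innerSL ℝ (e l) ((lam m * inner ℝ (e m) x) • e m))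
      (lam l * inner ℝ (e l) x) := by
    convert hasSum_single l ?_ using 1
    · simp [h.orthonormal.1 l]
    · intro m hm
      simp [h.orthonormal.2 hm.symm]
  simpa using h1.unique h2

theorem apply_vec (h : IsSpectralDecomp A lam e) (l : ℕ) : A (e l) = lam l • e l := by
  refine (h.hasSum_smul (e l)).unique ?_
  convert hasSum_single l ?_ using 1
  · simp [h.orthonormal.1 l]
  · intro m hm
    simp [h.orthonormal.2 hm]

/-- The factor λ⁻¹λ stays uncancelled: it is 0, not 1, at a vanishing eigenvalue. -/
theorem truncInv_comp_apply (h : IsSpectralDecomp A lam e) (k : ℕ) (x : H) :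
    truncInv lam e k (A x)
      = ∑ l ∈ Finset.range k, ((lam l)⁻¹ * lam l * inner ℝ (e l) x) • e l := by
  rw [truncInv_apply]
  exact Finset.sum_congr rfl fun l _ => by rw [h.inner_apply, mul_assoc]

theorem comp_truncInv_apply (h : IsSpectralDecomp A lam e) (k : ℕ) (x : H) :
    A (truncInv lam e k x) = truncInv lam e k (A x) := by
  rw [h.truncInv_comp_apply, truncInv_apply, map_sum]
  refine Finset.sum_congr rfl fun l _ => ?_
  rw [map_smul, h.apply_vec, smul_smul]
  congr 1
  ring

theorem truncInv_comp_truncInv (h : IsSpectralDecomp A lam e) (k : ℕ) (x : H) :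
    truncInv lam e k (A (truncInv lam e k x)) = truncInv lam e k x := by
  rw [h.truncInv_comp_apply]
  conv_rhs => rw [truncInv_apply]
  refine Finset.sum_congr rfl fun l hl => ?_
  rw [inner_truncInv h.orthonormal (Finset.mem_range.1 hl)]
  congr 1
  by_cases h0 : lam l = 0
  · simp [h0]
  · field_simp

/-- Γ_n† Γ_n is the orthogonal projection onto the leading eigenvectors with nonzero eigenvalue,
hence a contraction however small those eigenvalues are. -/
theorem norm_truncInv_comp_le (h : IsSpectralDecomp A lam e) (k : ℕ) (x : H) :
    ‖truncInv lam e k (A x)‖ ≤ ‖x‖ := by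
  rw [← one_mul ‖x‖, h.truncInv_comp_apply]
  refine norm_le_of_hasSum_orthonormal h.orthonormal
    (c := fun l => if l ∈ Finset.range k then (lam l)⁻¹ * lam l * inner ℝ (e l) x else 0)
    zero_le_one (fun l => ?_) ?_
  · split_ifs
    · rw [abs_mul]
      refine mul_le_mul_of_nonneg_right ?_ (abs_nonneg _)
      by_cases h0 : lam l = 0 <;> simp [h0]
    · simp
  · have h1 := hasSum_sum_of_ne_finset_zero (L := .unconditional ℕ) (s := Finset.range k) (f := fun l =>
      (if l ∈ Finset.range k then (lam l)⁻¹ * lam l * inner ℝ (e l) x else 0) • e l)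
      (fun l hl => by simp [hl])
    convert! h1 using 1
    exact Finset.sum_congr rfl fun l hl => by rw [if_pos hl]

/-- Only the eigenvalues from index k on survive in the difference, since a zero eigenvalue omitted
before k contributes nothing to A; monotonicity bounds them all by `lam k`. -/
theorem norm_apply_sub_le (h : IsSpectralDecomp A lam e) (k : ℕ) (x : H) :
    ‖A x - A (truncInv lam e k (A x))‖ ≤ lam k * ‖x‖ := by
  have h1 : A (truncInv lam e k (A x))
      = ∑ l ∈ Finset.range k, (lam l * inner ℝ (e l) x) • e l := by
    rw [h.truncInv_comp_apply, map_sum]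
    refine Finset.sum_congr rfl fun l _ => ?_
    rw [map_smul, h.apply_vec, smul_smul]
    congr 1
    by_cases h0 : lam l = 0
    · simp [h0]
    · field_simp
  have h2 := hasSum_sum_of_ne_finset_zero (L := .unconditional ℕ) (s := Finset.range k) (f := fun l =>
      if l ∈ Finset.range k then (lam l * inner ℝ (e l) x) • e l else 0)
      (fun l hl => by simp [hl])
  have h3 := (h.hasSum_smul x).sub h2
  rw [h1]
  refine norm_le_of_hasSum_orthonormal h.orthonormal
    (c := fun l => if l ∈ Finset.range k then 0 else lam l * inner ℝ (e l) x)
    (h.nonneg k) (fun l => ?_) ?_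
  · split_ifs with hl
    · simpa using mul_nonneg (h.nonneg k) (abs_nonneg _)
    · rw [abs_mul, abs_of_nonneg (h.nonneg l)]
      exact mul_le_mul_of_nonneg_right (h.antitone (by simpa using hl)) (abs_nonneg _)
  · convert! h3 using 1
    · funext l
      split_ifs <;> simp
    · congr 1
      exact Finset.sum_congr rfl fun l hl => by rw [if_pos hl]

end IsSpectralDecomp

/-! ### Decomposition of the estimation error along a fixed trajectory. -/

theorem empCov_apply (x : ℤ → H) (n : ℕ) (h : H) :
    empCov x n h = (n : ℝ)⁻¹ • ∑ k ∈ Finset.Icc 1 n, inner ℝ (x k) h • x k := by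
  simp [empCov, tensor_apply]

theorem norm_empCov_apply_le (x : ℤ → H) (n : ℕ) (h : H) :
    ‖empCov x n h‖ ≤ empTrace x n * ‖h‖ := by
  rw [empCov_apply, norm_smul, norm_inv, Real.norm_natCast, empTrace, mul_assoc, Finset.sum_mul]
  refine mul_le_mul_of_nonneg_left (norm_sum_le_of_le _ fun k _ => ?_) (by positivity)
  rw [norm_smul]
  calc ‖inner ℝ (x k) h‖ * ‖x k‖ ≤ (‖x k‖ * ‖h‖) * ‖x k‖ := by
        gcongr; exact norm_inner_le_norm _ _
    _ = _ := by ring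

/-- The first k eigenvalues are each at least `lam k`, and by Bessel their sum is at most the trace.
This sends the truncated eigenvalue to 0 without any consistency result for eigenvalues. -/
theorem mul_eigenvalue_le {x : ℤ → H} {n : ℕ} {lam : ℕ → ℝ} {e : ℕ → H}
    (h : IsSpectralDecomp (empCov x n) lam e) (k : ℕ) : k * lam k ≤ empTrace x n := by
  have h1 : ∀ l, lam l = (n : ℝ)⁻¹ * ∑ i ∈ Finset.Icc 1 n, ‖inner ℝ (e l) (x i)‖ ^ 2 := by
    intro l
    have h2 : inner ℝ (e l) (empCov x n (e l)) = lam l := by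
      rw [h.inner_apply]
      simp [h.orthonormal.1 l]
    rw [← h2, empCov_apply, inner_smul_right, inner_sum]
    congr 1
    refine Finset.sum_congr rfl fun i _ => ?_
    rw [inner_smul_right, real_inner_comm, Real.norm_eq_abs, sq_abs, pow_two]
  calc k * lam k = ∑ l ∈ Finset.range k, lam k := by simp
    _ ≤ ∑ l ∈ Finset.range k, lam l :=
        Finset.sum_le_sum fun l hl => h.antitone (Finset.mem_range.1 hl).le
    _ = (n : ℝ)⁻¹ * ∑ i ∈ Finset.Icc 1 n, ∑ l ∈ Finset.range k, ‖inner ℝ (e l) (x i)‖ ^ 2 := by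
        rw [Finset.sum_congr rfl fun l _ => h1 l, ← Finset.mul_sum, Finset.sum_comm]
    _ ≤ empTrace x n := by
        unfold empTrace
        gcongr
        exact h.orthonormal.sum_inner_products_le _

/-- The empirical cross-covariance operator of the process and its innovations. -/
noncomputable def empNoise (ρ : H →L[ℝ] H) (x : ℤ → H) (n : ℕ) : H →L[ℝ] H :=
  ((n : ℝ) - 1)⁻¹ • ∑ k ∈ Finset.Ico 1 n, tensor (x k) (x (k + 1) - ρ (x k))

theorem empNoise_apply (ρ : H →L[ℝ] H) (x : ℤ → H) (n : ℕ) (h : H) :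
    empNoise ρ x n h
      = ((n : ℝ) - 1)⁻¹ • ∑ k ∈ Finset.Ico 1 n, inner ℝ (x k) h • (x (k + 1) - ρ (x k)) := by
  simp [empNoise, tensor_apply]

/-- Substitute x_{k+1} = ρ x_k + (x_{k+1} - ρ x_k). The middle term corrects for Γ_n averaging n
terms while Δ_n averages the first n-1. -/
theorem empCross_apply (ρ : H →L[ℝ] H) (x : ℤ → H) {n : ℕ} (hn : 2 ≤ n) (h : H) :
    empCross x n h = ρ (empCov x n h)
      + ((n : ℝ) - 1)⁻¹ • ρ (empCov x n h - inner ℝ (x n) h • x n) + empNoise ρ x n h := by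
  have hn' : (n : ℝ) - 1 ≠ 0 := by
    have : (2 : ℝ) ≤ n := by exact_mod_cast hn
    linarith
  have hn0 : (n : ℝ) ≠ 0 := by positivity
  have h1 : empCross x n h = ((n : ℝ) - 1)⁻¹ • ∑ k ∈ Finset.Ico 1 n, inner ℝ (x k) h • x (k + 1) := by
    simp [empCross, tensor_apply]
  have h2 : ∑ k ∈ Finset.Icc 1 n, inner ℝ (x k) h • x k
      = ∑ k ∈ Finset.Ico 1 n, inner ℝ (x k) h • x k + inner ℝ (x n) h • x n := by
    rw [← Finset.Ico_insert_right (by omega), Finset.sum_insert (by simp), add_comm]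
  have h3 : (n : ℝ) • empCov x n h
      = ∑ k ∈ Finset.Ico 1 n, inner ℝ (x k) h • x k + inner ℝ (x n) h • x n := by
    rw [empCov_apply, h2, smul_smul, mul_inv_cancel₀ hn0, one_smul]
  have h4 : ∑ k ∈ Finset.Ico 1 n, inner ℝ (x k) h • x (k + 1)
      = ρ (∑ k ∈ Finset.Ico 1 n, inner ℝ (x k) h • x k)
        + ∑ k ∈ Finset.Ico 1 n, inner ℝ (x k) h • (x (k + 1) - ρ (x k)) := by
    rw [map_sum, ← Finset.sum_add_distrib]
    refine Finset.sum_congr rfl fun k _ => ?_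
    rw [map_smul, smul_sub, add_sub_cancel]
  have h5 : ∑ k ∈ Finset.Ico 1 n, inner ℝ (x k) h • x k
      = ((n : ℝ) - 1) • empCov x n h + (empCov x n h - inner ℝ (x n) h • x n) := by
    rw [sub_smul, h3, one_smul]
    abel
  rw [h1, empNoise_apply, h4, h5, map_add, map_smul, smul_add, smul_add, smul_smul,
    inv_mul_cancel₀ hn', one_smul]

/-- The error of the estimate, evaluated on the range of `Γ`, agrees with the noise operator up to
terms controlled by norms. -/
theorem norm_empNoise_sub_le (ρ : H →L[ℝ] H) {x : ℤ → H} {n : ℕ} (hn : 2 ≤ n) {k : ℕ} {lam : ℕ → ℝ}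
    {e : ℕ → H} (hs : IsSpectralDecomp (empCov x n) lam e) (Γ : H →L[ℝ] H) (h : H) :
    ‖empNoise ρ x n h - (estimator x n k lam e - ρ) (Γ h)‖
      ≤ ‖estimator x n k lam e - ρ‖ * (‖empCov x n h - Γ h‖ + lam k * ‖h‖)
        + ((n : ℝ) - 1)⁻¹ * (‖ρ‖ * ((empTrace x n + ‖x n‖ ^ 2) * ‖h‖))
        + ‖empNoise ρ x n‖ * ‖h - truncInv lam e k (empCov x n h)‖ := by
  set A := empCov x n with hA
  set R := truncInv lam e k
  set S := empNoise ρ x n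
  set E := estimator x n k lam e - ρ with hE
  -- The key identity: R A R = R makes the two occurrences of ρ cancel, leaving only the boundary
  -- term and the noise.
  have h1 : E (A (R (A h)))
      = ((n : ℝ) - 1)⁻¹ • ρ (A (R (A h)) - inner ℝ (x n) (R (A h)) • x n) + S (R (A h)) := by
    rw [hE, sub_apply, estimator, ContinuousLinearMap.comp_apply,
      hs.truncInv_comp_truncInv, empCross_apply ρ x hn, ← hA]
    abel
  have h2 : S h - E (Γ h) = E (A h - Γ h) - E (A h - A (R (A h)))
      - ((n : ℝ) - 1)⁻¹ • ρ (A (R (A h)) - inner ℝ (x n) (R (A h)) • x n)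
      + S (h - R (A h)) := by
    simp only [map_sub E, map_sub S, h1]
    abel
  have hn' : 0 ≤ ((n : ℝ) - 1)⁻¹ := by
    have : (2 : ℝ) ≤ n := by exact_mod_cast hn
    exact inv_nonneg.2 (by linarith)
  have hR := hs.norm_truncInv_comp_le k h
  have h3 : ‖ρ (A (R (A h)) - inner ℝ (x n) (R (A h)) • x n)‖
      ≤ ‖ρ‖ * ((empTrace x n + ‖x n‖ ^ 2) * ‖h‖) := by
    refine (ρ.le_opNorm _).trans (mul_le_mul_of_nonneg_left ?_ (norm_nonneg _))
    refine (norm_sub_le _ _).trans ?_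
    rw [add_mul]
    refine add_le_add ((norm_empCov_apply_le x n _).trans ?_) ?_
    · exact mul_le_mul_of_nonneg_left hR (empTrace_nonneg x n)
    · rw [norm_smul]
      calc ‖inner ℝ (x n) (R (A h))‖ * ‖x n‖ ≤ (‖x n‖ * ‖h‖) * ‖x n‖ := by
            gcongr
            exact (norm_inner_le_norm _ _).trans (by gcongr)
        _ = _ := by ring
  rw [h2]
  refine (norm_add_le _ _).trans (add_le_add ((norm_sub_le _ _).trans (add_le_add ?_ ?_))
    (S.le_opNorm _))
  · rw [mul_add]
    refine (norm_sub_le _ _).trans (add_le_add (E.le_opNorm _) ((E.le_opNorm _).trans ?_))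
    exact mul_le_mul_of_nonneg_left (hs.norm_apply_sub_le k h) (norm_nonneg _)
  · rw [norm_smul, Real.norm_of_nonneg hn']
    exact mul_le_mul_of_nonneg_left h3 hn'

/-- On the range of `Γ`, the spectral projection of the empirical covariance operator is close to
the identity. -/
theorem norm_sub_proj_le {A : H →L[ℝ] H} {lam : ℕ → ℝ} {e : ℕ → H} (hs : IsSpectralDecomp A lam e)
    (k : ℕ) (y h : H) :
    ‖y - truncInv lam e k (A y)‖ ≤ 2 * ‖y - A h‖ + lam k * ‖h‖ := by
  -- Approximate y by A h: on the range of A the projection misses at most `lam k * ‖h‖`, and on y -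
  -- A h the identity minus the projection costs a factor 2.
  have h1 : y - truncInv lam e k (A y)
      = (y - A h) - truncInv lam e k (A (y - A h)) + (A h - A (truncInv lam e k (A h))) := by
    rw [map_sub A, map_sub (truncInv lam e k), hs.comp_truncInv_apply k (A h)]
    abel
  rw [h1]
  refine (norm_add_le _ _).trans (add_le_add ((norm_sub_le _ _).trans ?_)
    (hs.norm_apply_sub_le k h))
  linarith [hs.norm_truncInv_comp_le k (y - A h)]

end Spectral

/-! ### Boundedness and smallness in probability. -/

section InProbability

variable {Ω : Type*} [MeasurableSpace Ω] {P : Measure Ω} {f g : ℕ → Ω → ℝ}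

/-- The positive parts of the functions `f n` are bounded in probability. -/
def BddInProb (P : Measure Ω) (f : ℕ → Ω → ℝ) : Prop :=
  ∀ η : ℝ, 0 < η → ∃ M : ℝ, 0 < M ∧ ∀ᶠ n in atTop, P {ω | M < f n ω} ≤ ENNReal.ofReal η

/-- The positive parts of the functions `f n` converge to `0` in probability. -/
def SmallInProb (P : Measure Ω) (f : ℕ → Ω → ℝ) : Prop :=
  ∀ δ : ℝ, 0 < δ → ∀ η : ℝ, 0 < η → ∀ᶠ n in atTop, P {ω | δ < f n ω} ≤ ENNReal.ofReal η

theorem SmallInProb.mono (hg : SmallInProb P g) (h : ∀ᶠ n in atTop, ∀ᵐ ω ∂P, f n ω ≤ g n ω) :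
    SmallInProb P f := by
  intro δ hδ η hη
  filter_upwards [hg δ hδ η hη, h] with n h1 h2
  refine (measure_mono_ae ?_).trans h1
  filter_upwards [h2] with ω h3 h4
  exact lt_of_lt_of_le h4 h3

theorem BddInProb.mono (hg : BddInProb P g) (h : ∀ᶠ n in atTop, ∀ᵐ ω ∂P, f n ω ≤ g n ω) :
    BddInProb P f := by
  intro η hη
  obtain ⟨M, hM, h1⟩ := hg η hη
  refine ⟨M, hM, ?_⟩
  filter_upwards [h1, h] with n h1 h2
  refine (measure_mono_ae ?_).trans h1
  filter_upwards [h2] with ω h3 h4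
  exact lt_of_lt_of_le h4 h3

theorem measure_le_ofReal_of_subset_union {s t u : Set Ω} {η : ℝ} (hη : 0 < η)
    (h : s ⊆ t ∪ u) (ht : P t ≤ ENNReal.ofReal (η / 2)) (hu : P u ≤ ENNReal.ofReal (η / 2)) :
    P s ≤ ENNReal.ofReal η := by
  calc P s ≤ P t + P u := (measure_mono h).trans (measure_union_le _ _)
    _ ≤ ENNReal.ofReal (η / 2) + ENNReal.ofReal (η / 2) := add_le_add ht hu
    _ = ENNReal.ofReal η := by
        rw [← ENNReal.ofReal_add (by positivity) (by positivity), add_halves]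

theorem SmallInProb.add (hf : SmallInProb P f) (hg : SmallInProb P g) :
    SmallInProb P (fun n ω => f n ω + g n ω) := by
  intro δ hδ η hη
  filter_upwards [hf (δ / 2) (by positivity) (η / 2) (by positivity),
    hg (δ / 2) (by positivity) (η / 2) (by positivity)] with n h1 h2
  refine measure_le_ofReal_of_subset_union hη (fun ω hω => ?_) h1 h2
  by_contra! h
  simp only [Set.mem_union, Set.mem_ofPred_eq, not_or, not_lt] at h hω
  linarith

theorem BddInProb.add (hf : BddInProb P f) (hg : BddInProb P g) :
    BddInProb P (fun n ω => f n ω + g n ω) := by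
  intro η hη
  obtain ⟨M, hM, h1⟩ := hf (η / 2) (by positivity)
  obtain ⟨N, hN, h2⟩ := hg (η / 2) (by positivity)
  refine ⟨M + N, by positivity, ?_⟩
  filter_upwards [h1, h2] with n h1 h2
  refine measure_le_ofReal_of_subset_union hη (fun ω hω => ?_) h1 h2
  by_contra! h
  simp only [Set.mem_union, Set.mem_ofPred_eq, not_or, not_lt] at h hω
  linarith

theorem BddInProb.mul_small (hf : BddInProb P f) (hg : SmallInProb P g)
    (hf0 : ∀ n ω, 0 ≤ f n ω) : SmallInProb P (fun n ω => f n ω * g n ω) := by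
  intro δ hδ η hη
  obtain ⟨M, hM, h1⟩ := hf (η / 2) (by positivity)
  filter_upwards [h1, hg (δ / M) (by positivity) (η / 2) (by positivity)] with n h1 h2
  refine measure_le_ofReal_of_subset_union hη (fun ω hω => ?_) h1 h2
  by_contra! h
  simp only [Set.mem_union, Set.mem_ofPred_eq, not_or, not_lt] at h hω
  have : f n ω * g n ω ≤ M * (δ / M) :=
    (mul_le_mul_of_nonneg_left h.2 (hf0 n ω)).trans
      (mul_le_mul_of_nonneg_right h.1 (by positivity))
  rw [mul_div_cancel₀ _ hM.ne'] at this
  linarith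

theorem BddInProb.tendsto_mul (hf : BddInProb P f) {a : ℕ → ℝ} (ha : Tendsto a atTop (𝓝 0))
    (ha0 : ∀ᶠ n in atTop, 0 ≤ a n) : SmallInProb P (fun n ω => a n * f n ω) := by
  intro δ hδ η hη
  obtain ⟨M, hM, h1⟩ := hf η hη
  filter_upwards [h1, ha0, ha.eventually (ge_mem_nhds (show 0 < δ / M by positivity))]
    with n h1 h2 h3
  refine (measure_mono fun ω hω => ?_).trans h1
  by_contra! h
  simp only [Set.mem_ofPred_eq, not_lt] at h hω
  have : a n * f n ω ≤ δ / M * M :=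
    (mul_le_mul_of_nonneg_left h h2).trans (mul_le_mul_of_nonneg_right h3 hM.le)
  rw [div_mul_cancel₀ _ hM.ne'] at this
  linarith

theorem BddInProb.const_mul (hf : BddInProb P f) {c : ℝ} (hc : 0 ≤ c) :
    BddInProb P (fun n ω => c * f n ω) := by
  intro η hη
  obtain ⟨M, hM, h1⟩ := hf η hη
  refine ⟨c * M + 1, by positivity, ?_⟩
  filter_upwards [h1] with n h1
  refine (measure_mono fun ω hω => ?_).trans h1
  by_contra! h
  simp only [Set.mem_ofPred_eq, not_lt] at h hω
  nlinarith [mul_le_mul_of_nonneg_left h hc]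

theorem SmallInProb.const_mul (hf : SmallInProb P f) {c : ℝ} (hc : 0 ≤ c) :
    SmallInProb P (fun n ω => c * f n ω) := by
  intro δ hδ η hη
  -- The denominator c + 1 allows c = 0.
  filter_upwards [hf (δ / (c + 1)) (by positivity) η hη] with n h1
  refine (measure_mono fun ω hω => ?_).trans h1
  by_contra! h
  simp only [Set.mem_ofPred_eq, not_lt] at h hω
  rw [le_div_iff₀ (by positivity)] at h
  by_cases h0 : 0 ≤ f n ω
  · nlinarith
  · nlinarith [mul_nonneg hc (neg_nonneg.2 (not_le.1 h0).le)]

theorem measure_lt_le_of_integral_le {h : Ω → ℝ} (hi : Integrable h P) (h0 : ∀ ω, 0 ≤ h ω)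
    {M C : ℝ} (hM : 0 < M) (hC : ∫ ω, h ω ∂P ≤ C) : P {ω | M < h ω} ≤ ENNReal.ofReal (C / M) := by
  have h1 := meas_ge_le_lintegral_div (μ := P) (f := fun ω => ENNReal.ofReal (h ω))
    hi.aemeasurable.ennreal_ofReal (ε := ENNReal.ofReal M) (by simpa using hM)
    ENNReal.ofReal_ne_top
  rw [← ofReal_integral_eq_lintegral_ofReal hi (Eventually.of_forall h0),
    ← ENNReal.ofReal_div_of_pos hM] at h1
  refine (measure_mono fun ω hω => ?_).trans (h1.trans (ENNReal.ofReal_le_ofReal (by gcongr)))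
  exact ENNReal.ofReal_le_ofReal (le_of_lt hω)

theorem bddInProb_of_integral_le (hi : ∀ n, Integrable (f n) P) (h0 : ∀ n ω, 0 ≤ f n ω) {C : ℝ}
    (hC : ∀ᶠ n in atTop, ∫ ω, f n ω ∂P ≤ C) : BddInProb P f := by
  intro η hη
  refine ⟨(|C| + 1) / η, by positivity, ?_⟩
  filter_upwards [hC] with n hn
  refine (measure_lt_le_of_integral_le (hi n) (h0 n) (by positivity)
    (hn.trans ((le_abs_self C).trans (lt_add_one _).le))).trans (ENNReal.ofReal_le_ofReal ?_)
  rw [div_div_cancel₀ (by positivity)]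

theorem smallInProb_of_tendsto_integral (hi : ∀ n, Integrable (f n) P) (h0 : ∀ n ω, 0 ≤ f n ω)
    (hC : Tendsto (fun n => ∫ ω, f n ω ∂P) atTop (𝓝 0)) : SmallInProb P f := by
  intro δ hδ η hη
  filter_upwards [hC.eventually (ge_mem_nhds (show 0 < η * δ by positivity))] with n hn
  refine (measure_lt_le_of_integral_le (hi n) (h0 n) hδ hn).trans (ENNReal.ofReal_le_ofReal ?_)
  rw [mul_div_cancel_right₀ _ hδ.ne']

theorem bddInProb_of_sq (hf : BddInProb P (fun n ω => f n ω ^ 2)) : BddInProb P f := by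
  intro η hη
  obtain ⟨M, hM, h1⟩ := hf η hη
  refine ⟨M + 1, by positivity, ?_⟩
  filter_upwards [h1] with n h1
  refine (measure_mono fun ω hω => ?_).trans h1
  simp only [Set.mem_ofPred_eq] at hω ⊢
  nlinarith

end InProbability

/-! ### Moving-average representation, moments and adaptedness of the process. -/

section Autoregression

set_option linter.unusedSectionVars false

theorem norm_pow_apply_le {H : Type*} [NormedAddCommGroup H] [InnerProductSpace ℝ H]
    (ρ : H →L[ℝ] H) (m : ℕ) (x : H) : ‖(ρ ^ m) x‖ ≤ ‖ρ‖ ^ m * ‖x‖ := by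
  induction m with
  | zero => simp
  | succ m ih =>
    rw [pow_succ', mul_apply_eq_comp, pow_succ', mul_assoc]
    exact (ρ.le_opNorm _).trans (by gcongr)

variable {H : Type*} [NormedAddCommGroup H] [InnerProductSpace ℝ H] [MeasurableSpace H]
  [BorelSpace H] {Ω : Type*} [mΩ : MeasurableSpace Ω] {P : Measure Ω}
  {ρ : H →L[ℝ] H} {X ε : ℤ → Ω → H}

/-- The σ-algebra generated by the innovations up to time `n`. -/
abbrev past (ε : ℤ → Ω → H) (n : ℤ) : MeasurableSpace Ω :=
  ⨆ j ∈ Set.Iic n, MeasurableSpace.comap (ε j) inferInstance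

theorem past_mono (ε : ℤ → Ω → H) : Monotone (past ε) := fun _ _ h =>
  biSup_mono fun _ hj => le_trans hj h

theorem measurable_past (ε : ℤ → Ω → H) {j n : ℤ} (h : j ≤ n) : Measurable[past ε n] (ε j) :=
  (comap_measurable (ε j)).mono
    (le_iSup₂_of_le (f := fun j (_ : j ∈ Set.Iic n) =>
      MeasurableSpace.comap (ε j) (inferInstance : MeasurableSpace H)) j h le_rfl) le_rfl

namespace IsFAR1

theorem past_le (hX : IsFAR1 P ρ X ε) (n : ℤ) : past ε n ≤ mΩ :=
  iSup₂_le fun j _ => (hX.measurable_noise j).comap_le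

/-- The martingale arguments need independence from the whole past of the innovations, which comes
from grouping independent innovations over disjoint index sets. -/
theorem indep_past_noise (hX : IsFAR1 P ρ X ε) {m n : ℤ} (h : m < n) :
    Indep (past ε m) (MeasurableSpace.comap (ε n) inferInstance) P := by
  have h1 := indep_iSup_of_disjoint (fun i => (hX.measurable_noise i).comap_le)
    ((iIndepFun_iff_iIndep _ _ _).1 hX.iIndep_noise) (S := Set.Iic m) (T := {n})
    (by simpa using h)
  simpa [past] using h1

theorem identDistrib_process (hX : IsFAR1 P ρ X ε) (n : ℤ) : IdentDistrib (X n) (X 0) P P := by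
  simpa [Function.comp_def] using (hX.stationary n).comp (measurable_pi_apply (0 : ℤ))

/-- The truncated moving-average representation `∑_{j<m} ρ^j ε_{n-j}`. -/
def movingAverage (ρ : H →L[ℝ] H) (ε : ℤ → Ω → H) (m : ℕ) (n : ℤ) (ω : Ω) : H :=
  ∑ j ∈ Finset.range m, (ρ ^ j) (ε (n - j) ω)

theorem ae_eq_movingAverage (hX : IsFAR1 P ρ X ε) (m : ℕ) (n : ℤ) :
    ∀ᵐ ω ∂P, X n ω = (ρ ^ m) (X (n - m) ω) + movingAverage ρ ε m n ω := by
  induction m with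
  | zero => simp [movingAverage]
  | succ m ih =>
    filter_upwards [ih, hX.recursion (n - m)] with ω h1 h2
    rw [movingAverage, Finset.sum_range_succ, h1, h2, map_add, pow_succ,
      mul_apply_eq_comp, movingAverage, Nat.cast_succ, sub_add_eq_sub_sub]
    abel

variable [SecondCountableTopology H]

theorem measurable_movingAverage (m : ℕ) (n : ℤ) :
    Measurable[past ε n] (movingAverage ρ ε m n) := by
  unfold movingAverage
  refine Finset.measurable_fun_sum _ fun j _ => ?_
  exact (ρ ^ j).continuous.measurable.comp (measurable_past ε (by omega))

/-- The remainder is ρ^m X_{n-m}. By stationarity its norm has tails bounded by those of ‖ρ‖^m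
‖X_0‖, which tends to 0 pointwise, so no moment is required. -/
theorem tendstoInMeasure_movingAverage [IsFiniteMeasure P] (hX : IsFAR1 P ρ X ε) (hρ : ‖ρ‖ < 1)
    (n : ℤ) : TendstoInMeasure P (fun m => movingAverage ρ ε m n) atTop (X n) := by
  have h1 : TendstoInMeasure P (fun (m : ℕ) ω => ‖ρ‖ ^ m * ‖X 0 ω‖) atTop (fun _ => 0) := by
    refine tendstoInMeasure_of_tendsto_ae (fun m => ?_) (Eventually.of_forall fun ω => ?_)
    · exact ((hX.measurable_process 0).norm.const_mul _).aestronglyMeasurable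
    · simpa using (tendsto_pow_atTop_nhds_zero_of_lt_one (norm_nonneg ρ) hρ).mul_const ‖X 0 ω‖
  rw [tendstoInMeasure_iff_norm] at h1 ⊢
  intro δ hδ
  refine tendsto_of_tendsto_of_tendsto_of_le_of_le tendsto_const_nhds (h1 δ hδ)
    (fun _ => zero_le) fun m => ?_
  have h2 := (((hX.identDistrib_process (n - m)).comp
    ((measurable_norm (α := H)).const_mul (‖ρ‖ ^ m))).measure_mem_eq (measurableSet_Ici (a := δ)))
  have h3 : P {ω | δ ≤ ‖‖ρ‖ ^ m * ‖X 0 ω‖ - 0‖}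
      = P {ω | δ ≤ ‖ρ‖ ^ m * ‖X (n - m) ω‖} := by
    simpa [Set.preimage] using h2.symm
  dsimp only
  rw [h3]
  refine measure_mono_ae ?_
  filter_upwards [hX.ae_eq_movingAverage m n] with ω hω h4
  refine le_trans (show δ ≤ _ from h4) ?_
  rw [hω, sub_add_cancel_right, norm_neg]
  exact norm_pow_apply_le ρ m _

/-- Second moments pass from the innovations to the process: a geometric series bounds the L² norms
of the moving averages uniformly, and Fatou applies along an a.e. convergent subsequence. -/
theorem memLp_process [IsProbabilityMeasure P] (hX : IsFAR1 P ρ X ε) (hρ : ‖ρ‖ < 1)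
    (hε : MemLp (ε 0) 2 P) (n : ℤ) : MemLp (X n) 2 P := by
  refine ⟨(hX.measurable_process n).aestronglyMeasurable, ?_⟩
  obtain ⟨ns, -, hns⟩ := (hX.tendstoInMeasure_movingAverage hρ n).exists_seq_tendsto_ae
  have hm : ∀ m j, AEStronglyMeasurable (fun ω => (ρ ^ m) (ε j ω)) P := fun m j =>
    ((ρ ^ m).continuous.measurable.comp (hX.measurable_noise j)).aestronglyMeasurable
  have hC : ∀ m, eLpNorm (movingAverage ρ ε m n) 2 P ≤ (1 - ‖ρ‖ₑ)⁻¹ * eLpNorm (ε 0) 2 P := by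
    intro m
    have h1 : movingAverage ρ ε m n
        = ∑ j ∈ Finset.range m, fun ω => (ρ ^ j) (ε (n - j) ω) := by
      ext ω; simp [movingAverage]
    rw [h1]
    refine (eLpNorm_sum_le (fun j _ => hm j _) (by norm_num)).trans ?_
    rw [← ENNReal.tsum_geometric, ← ENNReal.tsum_mul_right]
    refine le_trans (Finset.sum_le_sum fun j _ => ?_) (ENNReal.sum_le_tsum (Finset.range m))
    rw [← (hX.identDistrib_noise (n - j)).eLpNorm_eq]
    refine eLpNorm_le_mul_eLpNorm_of_ae_le_mul'' 2
      (hX.measurable_noise _).aestronglyMeasurable (Eventually.of_forall fun ω => ?_)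
    rw [← ofReal_norm, ← ofReal_norm, ← ofReal_norm, ← ENNReal.ofReal_pow (norm_nonneg _),
      ← ENNReal.ofReal_mul (by positivity)]
    exact ENNReal.ofReal_le_ofReal (norm_pow_apply_le ρ j _)
  refine lt_of_le_of_lt (Lp.eLpNorm_lim_le_liminf_eLpNorm
    (fun i => ((measurable_movingAverage (ρ := ρ) (ε := ε) (ns i) n).mono
      (hX.past_le n) le_rfl).aestronglyMeasurable) (X n) hns)
    (lt_of_le_of_lt (liminf_le_of_frequently_le'
      (Eventually.of_forall fun i => hC (ns i)).frequently) ?_)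
  refine ENNReal.mul_lt_top ?_ hε.2
  rw [ENNReal.inv_lt_top, tsub_pos_iff_lt, ← ofReal_norm]
  exact ENNReal.ofReal_lt_one.2 hρ

/-- The process has a version adapted to the filtration of the innovations. -/
theorem exists_adapted [CompleteSpace H] [IsFiniteMeasure P] (hX : IsFAR1 P ρ X ε) (hρ : ‖ρ‖ < 1) :
    ∃ X' : ℤ → Ω → H, (∀ n, StronglyMeasurable[past ε n] (X' n)) ∧ ∀ n, X n =ᵐ[P] X' n := by
  have h : ∀ n, ∃ x : Ω → H, StronglyMeasurable[past ε n] x ∧ X n =ᵐ[P] x := by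
    intro n
    obtain ⟨ns, -, hns⟩ := (hX.tendstoInMeasure_movingAverage hρ n).exists_seq_tendsto_ae
    -- Taking the limit of moving averages as the version makes it measurable for the past, null
    -- sets included.
    refine ⟨fun ω => limUnder atTop fun i => movingAverage ρ ε (ns i) n ω, ?_, ?_⟩
    · exact @StronglyMeasurable.limUnder _ _ _ (past ε n) _ _ _ _ _ _ _ fun i =>
        (measurable_movingAverage (ns i) n).stronglyMeasurable
    · filter_upwards [hns] with ω hω
      exact hω.limUnder_eq.symm
  choose X' h1 h2 using h
  exact ⟨X', h1, h2⟩

end IsFAR1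

end Autoregression

/-! ### Law of large numbers by blocking and truncation of the moving average. -/

section LawOfLargeNumbers

set_option linter.unusedSectionVars false

theorem sum_range_mul_add {M : Type*} [AddCommMonoid M] (f : ℕ → M) (m q : ℕ) :
    ∑ k ∈ Finset.range (m * q), f k
      = ∑ r ∈ Finset.range m, ∑ i ∈ Finset.range q, f (r + m * i) := by
  induction q with
  | zero => simp
  | succ q ih =>
    rw [mul_add, mul_one, Finset.sum_range_add, ih, ← Finset.sum_add_distrib]
    refine Finset.sum_congr rfl fun r _ => ?_
    rw [Finset.sum_range_succ, add_comm r]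

/-- The averages of a sequence are small in `L¹` as soon as, for arbitrarily small `δ`, those along
the residue classes of some modulus are eventually of norm at most `δ`. -/
theorem tendsto_integral_norm_average {Ω E : Type*} [MeasurableSpace Ω] {P : Measure Ω}
    [NormedAddCommGroup E] [NormedSpace ℝ E] {W : ℕ → Ω → E} (hW : ∀ k, Integrable (W k) P) {C : ℝ}
    (hC : ∀ k, ∫ ω, ‖W k ω‖ ∂P ≤ C)
    (h : ∀ δ : ℝ, 0 < δ → ∃ m : ℕ, 0 < m ∧ ∀ r, ∀ᶠ q : ℕ in atTop,
      ∫ ω, ‖∑ i ∈ Finset.range q, W (r + m * i) ω‖ ∂P ≤ δ * q) :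
    Tendsto (fun n : ℕ => ∫ ω, ‖(n : ℝ)⁻¹ • ∑ k ∈ Finset.range n, W k ω‖ ∂P) atTop (𝓝 0) := by
  have hC0 : 0 ≤ C := (integral_nonneg fun _ => norm_nonneg _).trans (hC 0)
  rw [Metric.tendsto_atTop']
  intro η hη
  obtain ⟨m, hm, h1⟩ := h (η / 3) (by positivity)
  have h2 : ∀ᶠ q : ℕ in atTop, ∀ r ∈ Finset.range m,
      ∫ ω, ‖∑ i ∈ Finset.range q, W (r + m * i) ω‖ ∂P ≤ η / 3 * q :=
    (Filter.eventually_all_finset _).2 fun r _ => h1 r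
  have h3 : ∀ᶠ n : ℕ in atTop, ∀ r ∈ Finset.range m,
      ∫ ω, ‖∑ i ∈ Finset.range (n / m), W (r + m * i) ω‖ ∂P ≤ η / 3 * (n / m : ℕ) :=
    (Nat.tendsto_div_const_atTop hm.ne').eventually h2
  -- The fewer than m terms left over after the complete blocks cost at most m C, negligible against
  -- n.
  have h4 : ∀ᶠ n : ℕ in atTop, m * C ≤ η / 3 * n :=
    (tendsto_natCast_atTop_atTop.const_mul_atTop (show 0 < η / 3 by positivity)).eventually_ge_atTop _
  obtain ⟨N, hN⟩ := eventually_atTop.1 (h3.and (h4.and (eventually_gt_atTop 0)))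
  refine ⟨N, fun n hn => ?_⟩
  obtain ⟨h5, h6, h7⟩ := hN n hn.le
  have hsum : ∀ s : Finset ℕ, ∀ g : ℕ → ℕ, Integrable (fun ω => ∑ i ∈ s, W (g i) ω) P := fun s g =>
    integrable_finsetSum _ fun i _ => hW _
  have h8 : ∫ ω, ‖∑ k ∈ Finset.range n, W k ω‖ ∂P ≤ η / 3 * n + m * C := by
    have h9 : ∀ ω, ‖∑ k ∈ Finset.range n, W k ω‖
        ≤ ∑ r ∈ Finset.range m, ‖∑ i ∈ Finset.range (n / m), W (r + m * i) ω‖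
          + ∑ r ∈ Finset.range (n % m), ‖W (m * (n / m) + r) ω‖ := by
      intro ω
      conv_lhs => rw [← Nat.div_add_mod n m]
      rw [Finset.sum_range_add, sum_range_mul_add]
      exact (norm_add_le _ _).trans (add_le_add (norm_sum_le _ _) (norm_sum_le _ _))
    have hi1 : Integrable (fun ω => ∑ r ∈ Finset.range m,
        ‖∑ i ∈ Finset.range (n / m), W (r + m * i) ω‖) P :=
      integrable_finsetSum _ fun r _ => (hsum _ _).norm
    have hi2 : Integrable (fun ω => ∑ r ∈ Finset.range (n % m), ‖W (m * (n / m) + r) ω‖) P :=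
      integrable_finsetSum _ fun r _ => (hW _).norm
    refine (integral_mono (hsum _ _).norm (hi1.add hi2) h9).trans ?_
    simp only [Pi.add_apply]
    rw [integral_add hi1 hi2, integral_finsetSum _ fun r _ => (hsum _ _).norm,
      integral_finsetSum _ fun r _ => (hW _).norm]
    refine add_le_add ((Finset.sum_le_sum h5).trans ?_)
      ((Finset.sum_le_sum fun r _ => hC _).trans ?_)
    · rw [Finset.sum_const, Finset.card_range, nsmul_eq_mul, mul_left_comm]
      gcongr
      exact_mod_cast Nat.mul_div_le n m
    · rw [Finset.sum_const, Finset.card_range, nsmul_eq_mul]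
      gcongr
      exact (Nat.mod_lt n hm).le
  have hn0 : (0 : ℝ) < n := by exact_mod_cast h7
  have h10 : ∫ ω, ‖(n : ℝ)⁻¹ • ∑ k ∈ Finset.range n, W k ω‖ ∂P
      = (n : ℝ)⁻¹ * ∫ ω, ‖∑ k ∈ Finset.range n, W k ω‖ ∂P := by
    simp_rw [norm_smul]
    rw [integral_const_mul]
    simp
  rw [Real.dist_eq, sub_zero, abs_of_nonneg (integral_nonneg fun _ => norm_nonneg _), h10,
    inv_mul_lt_iff₀ hn0]
  nlinarith

variable {H : Type*} [NormedAddCommGroup H] [InnerProductSpace ℝ H] [CompleteSpace H]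
  [SecondCountableTopology H] [MeasurableSpace H]
  [BorelSpace H] {Ω : Type*} [mΩ : MeasurableSpace Ω] {P : Measure Ω} [IsProbabilityMeasure P]
  {ρ : H →L[ℝ] H} {X ε : ℤ → Ω → H}

theorem continuous_inner_smul_self (x : H) : Continuous fun y : H => inner ℝ y x • y := by
  fun_prop

/-- Applied with a = X_n and b = ρ^m X_{n-m}, so that a - b is the truncated moving average. -/
theorem norm_inner_smul_self_sub_le (x a b : H) :
    ‖inner ℝ a x • a - inner ℝ (a - b) x • (a - b)‖ ≤ ‖x‖ * (2 * (‖a‖ * ‖b‖) + ‖b‖ ^ 2) := by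
  have h1 : inner ℝ a x • a - inner ℝ (a - b) x • (a - b)
      = inner ℝ a x • b + inner ℝ b x • a - inner ℝ b x • b := by
    rw [inner_sub_left, smul_sub, sub_smul, sub_smul]
    abel
  have h2 : ∀ u v : H, ‖inner ℝ u x • v‖ ≤ ‖u‖ * ‖v‖ * ‖x‖ := fun u v => by
    rw [norm_smul]
    calc ‖inner ℝ u x‖ * ‖v‖ ≤ (‖u‖ * ‖x‖) * ‖v‖ := by gcongr; exact norm_inner_le_norm _ _
      _ = _ := by ring
  rw [h1]
  refine (norm_sub_le _ _).trans ((add_le_add_left (norm_add_le _ _) _).trans ?_)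
  linarith [h2 a b, h2 b a, h2 b b]

end LawOfLargeNumbers

section LawOfLargeNumbers

set_option linter.unusedSectionVars false

variable {H : Type*} [NormedAddCommGroup H] [InnerProductSpace ℝ H] [CompleteSpace H]
  [SecondCountableTopology H] [MeasurableSpace H]
  [BorelSpace H] {Ω : Type*} [mΩ : MeasurableSpace Ω] {P : Measure Ω} [IsProbabilityMeasure P]
  {ρ : H →L[ℝ] H} {X ε : ℤ → Ω → H}

namespace IsFAR1

/-- The two moving averages read innovations in the disjoint windows (n-m, n] and (n'-m, n']. -/
theorem indepFun_movingAverage (hX : IsFAR1 P ρ X ε) {m : ℕ} {n n' : ℤ} (h : n + m ≤ n') :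
    IndepFun (movingAverage ρ ε m n) (movingAverage ρ ε m n') P := by
  have hmeas : ∀ n : ℤ, Measurable[⨆ j ∈ Set.Ioc (n - m) n,
      MeasurableSpace.comap (ε j) inferInstance] (movingAverage ρ ε m n) := by
    intro n
    unfold movingAverage
    refine Finset.measurable_fun_sum _ fun j hj => ?_
    have hj' := Finset.mem_range.1 hj
    refine (ρ ^ j).continuous.measurable.comp ((comap_measurable (ε (n - j))).mono
      (le_iSup₂_of_le (f := fun j (_ : j ∈ Set.Ioc (n - m) n) =>
        MeasurableSpace.comap (ε j) (inferInstance : MeasurableSpace H)) (n - j) ?_ le_rfl) le_rfl)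
    exact ⟨by omega, by omega⟩
  have h1 := indep_iSup_of_disjoint (fun i => (hX.measurable_noise i).comap_le)
    ((iIndepFun_iff_iIndep _ _ _).1 hX.iIndep_noise) (S := Set.Ioc (n - m) n)
    (T := Set.Ioc (n' - m) n')
    (Set.disjoint_left.2 fun j hj hj' => by
      simp only [Set.mem_Ioc] at hj hj'; omega)
  exact (IndepFun_iff_Indep _ _ _).2
    (indep_of_indep_of_le_left (indep_of_indep_of_le_right h1 (hmeas n').comap_le)
      (hmeas n).comap_le)

/-- Almost surely the moving average is X_n - ρ^m X_{n-m}, a fixed function of the shifted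
trajectory, so stationarity of the process suffices. -/
theorem identDistrib_movingAverage (hX : IsFAR1 P ρ X ε) (m : ℕ) (n : ℤ) :
    IdentDistrib (movingAverage ρ ε m n) (movingAverage ρ ε m 0) P P := by
  have h1 : ∀ n : ℤ, (fun ω => X n ω - (ρ ^ m) (X (n - m) ω)) =ᵐ[P] movingAverage ρ ε m n := by
    intro n
    filter_upwards [hX.ae_eq_movingAverage m n] with ω hω
    rw [hω, add_sub_cancel_left]
  have hmeas : ∀ n : ℤ, AEMeasurable (movingAverage ρ ε m n) P := fun n =>
    ((measurable_movingAverage m n).mono (hX.past_le n) le_rfl).aemeasurable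
  have h2 : Measurable fun x : ℤ → H => x 0 - (ρ ^ m) (x (-m)) :=
    (measurable_pi_apply _).sub ((ρ ^ m).continuous.measurable.comp (measurable_pi_apply _))
  have h3 : IdentDistrib (fun ω => X n ω - (ρ ^ m) (X (n - m) ω))
      (fun ω => X 0 ω - (ρ ^ m) (X (0 - m) ω)) P P := by
    simpa [Function.comp_def, sub_eq_neg_add] using (hX.stationary n).comp h2
  exact ((IdentDistrib.of_ae_eq (hmeas n) (h1 n).symm).trans h3).trans
    (IdentDistrib.of_ae_eq (h3.aemeasurable_snd) (h1 0))

theorem integral_comp_process (hX : IsFAR1 P ρ X ε) {E : Type*} [NormedAddCommGroup E]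
    [NormedSpace ℝ E] [MeasurableSpace E] [BorelSpace E] {f : H → E} (hf : Measurable f) (n : ℤ) :
    ∫ ω, f (X n ω) ∂P = ∫ ω, f (X 0 ω) ∂P :=
  ((hX.identDistrib_process n).comp hf).integral_eq

theorem integrable_inner_smul_self {Y : Ω → H} (hY : MemLp Y 2 P) (x : H) :
    Integrable (fun ω => inner ℝ (Y ω) x • Y ω) P := by
  refine (hY.integrable_norm_pow two_ne_zero |>.const_mul ‖x‖).mono'
    ((continuous_inner_smul_self x).comp_aestronglyMeasurable hY.1) (Eventually.of_forall fun ω => ?_)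
  rw [norm_smul]
  calc ‖inner ℝ (Y ω) x‖ * ‖Y ω‖ ≤ (‖Y ω‖ * ‖x‖) * ‖Y ω‖ := by
        gcongr; exact norm_inner_le_norm _ _
    _ = _ := by ring

theorem memLp_movingAverage (hX : IsFAR1 P ρ X ε) (hL : ∀ n, MemLp (X n) 2 P) (m : ℕ) (n : ℤ) :
    MemLp (movingAverage ρ ε m n) 2 P := by
  refine ((hL n).sub ((ρ ^ m).comp_memLp' (hL (n - m)))).ae_eq ?_
  filter_upwards [hX.ae_eq_movingAverage m n] with ω hω
  simp [hω]

theorem integral_norm_sub_movingAverage_le (hX : IsFAR1 P ρ X ε) (hL : ∀ n, MemLp (X n) 2 P)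
    (hρ : ‖ρ‖ < 1) (x : H) (m : ℕ) (n : ℤ) :
    ∫ ω, ‖inner ℝ (X n ω) x • X n ω
        - inner ℝ (movingAverage ρ ε m n ω) x • movingAverage ρ ε m n ω‖ ∂P
      ≤ ‖ρ‖ ^ m * (‖x‖ * (3 * ∫ ω, ‖X 0 ω‖ ^ 2 ∂P)) := by
  have hi : ∀ n, Integrable (fun ω => ‖X n ω‖ ^ 2) P := fun n =>
    (hL n).integrable_norm_pow two_ne_zero
  have hsq : ∀ n, ∫ ω, ‖X n ω‖ ^ 2 ∂P = ∫ ω, ‖X 0 ω‖ ^ 2 ∂P := fun n =>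
    hX.integral_comp_process (f := fun y => ‖y‖ ^ 2) (by fun_prop) n
  have h1 : ∫ ω, ‖ρ‖ ^ m * (‖x‖ * (‖X n ω‖ ^ 2 + 2 * ‖X (n - m) ω‖ ^ 2)) ∂P
      = ‖ρ‖ ^ m * (‖x‖ * (3 * ∫ ω, ‖X 0 ω‖ ^ 2 ∂P)) := by
    rw [integral_const_mul, integral_const_mul, integral_add (hi n) ((hi _).const_mul 2),
      integral_const_mul, hsq n, hsq (n - m)]
    ring
  rw [← h1]
  refine integral_mono_of_nonneg (Eventually.of_forall fun _ => norm_nonneg _)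
    ((((hi n).add ((hi _).const_mul 2)).const_mul _).const_mul _) ?_
  filter_upwards [hX.ae_eq_movingAverage m n] with ω hω
  have h2 : movingAverage ρ ε m n ω = X n ω - (ρ ^ m) (X (n - m) ω) := by
    rw [hω, add_sub_cancel_left]
  rw [h2]
  refine (norm_inner_smul_self_sub_le x _ _).trans ?_
  have h3 := norm_pow_apply_le ρ m (X (n - m) ω)
  have h4 : ‖ρ‖ ^ m ≤ 1 := pow_le_one₀ (norm_nonneg _) hρ.le
  set a := ‖X n ω‖
  set c := ‖ρ‖ ^ m
  have hc : 0 ≤ c := by positivity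
  set y := ‖X (n - m) ω‖
  have hy : 0 ≤ y := norm_nonneg _
  have ha : 0 ≤ a := norm_nonneg _
  rw [mul_left_comm c]
  refine mul_le_mul_of_nonneg_left ?_ (norm_nonneg x)
  -- Uses c² ≤ c and 2ay ≤ a² + y², keeping one factor c = ‖ρ‖^m for the geometric rate.
  calc 2 * (a * ‖(ρ ^ m) (X (n - m) ω)‖) + ‖(ρ ^ m) (X (n - m) ω)‖ ^ 2
      ≤ 2 * (a * (c * y)) + (c * y) ^ 2 := by gcongr
    _ ≤ 2 * (a * (c * y)) + c * y ^ 2 := by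
        rw [mul_pow]
        gcongr
        nlinarith
    _ ≤ c * (a ^ 2 + 2 * y ^ 2) := by nlinarith [mul_nonneg hc (sq_nonneg (a - y))]

/-- Along times spaced by m the summands are pairwise independent and identically distributed, so
the strong law holds in L¹. -/
theorem tendsto_integral_movingAverage_average (hX : IsFAR1 P ρ X ε) (hL : ∀ n, MemLp (X n) 2 P)
    (x : H) (m : ℕ) (s : ℤ) :
    Tendsto (fun q : ℕ => ∫ ω, ‖(q : ℝ)⁻¹ • ∑ i ∈ Finset.range q,
        inner ℝ (movingAverage ρ ε m (s + m * i) ω) x • movingAverage ρ ε m (s + m * i) ω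
        - ∫ ω, inner ℝ (movingAverage ρ ε m 0 ω) x • movingAverage ρ ε m 0 ω ∂P‖ ∂P)
      atTop (𝓝 0) := by
  have hf := (continuous_inner_smul_self x).measurable
  have hid : ∀ n n', IdentDistrib
      (fun ω => inner ℝ (movingAverage ρ ε m n ω) x • movingAverage ρ ε m n ω)
      (fun ω => inner ℝ (movingAverage ρ ε m n' ω) x • movingAverage ρ ε m n' ω) P P := fun n n' =>
    ((hX.identDistrib_movingAverage m n).trans (hX.identDistrib_movingAverage m n').symm).comp hf
  have h1 := strong_law_Lp (μ := P) (p := 1) le_rfl (by simp)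
    (fun (i : ℕ) ω => inner ℝ (movingAverage ρ ε m (s + m * i) ω) x • movingAverage ρ ε m (s + m * i) ω)
    (memLp_one_iff_integrable.2
      (integrable_inner_smul_self (hX.memLp_movingAverage hL m _) x)) ?_ (fun i => hid _ _)
  · have h2 := (ENNReal.tendsto_toReal ENNReal.zero_ne_top).comp h1
    rw [ENNReal.toReal_zero] at h2
    refine h2.congr fun q => ?_
    rw [Function.comp_apply, eLpNorm_one_eq_lintegral_enorm, integral_norm_eq_lintegral_enorm]
    · rw [(hid (s + m * (0 : ℕ)) 0).integral_eq]
    · refine AEStronglyMeasurable.sub (AEStronglyMeasurable.const_smul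
        (Finset.aestronglyMeasurable_fun_sum _ fun i _ =>
          (integrable_inner_smul_self (hX.memLp_movingAverage hL m _) x).1) _)
        aestronglyMeasurable_const
  · have key : ∀ i j : ℕ, i < j → IndepFun
        (fun ω => inner ℝ (movingAverage ρ ε m (s + m * i) ω) x • movingAverage ρ ε m (s + m * i) ω)
        (fun ω => inner ℝ (movingAverage ρ ε m (s + m * j) ω) x • movingAverage ρ ε m (s + m * j) ω)
        P := fun i j hij => by
      refine (hX.indepFun_movingAverage (m := m) ?_).comp hf hf
      have : (i : ℤ) + 1 ≤ j := by exact_mod_cast hij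
      nlinarith
    intro i j hij
    rcases lt_or_gt_of_ne hij with h | h
    · exact key i j h
    · exact (key j i h).symm

/-- The law of large numbers for the empirical covariance operator. -/
theorem tendsto_integral_average (hX : IsFAR1 P ρ X ε) (hL : ∀ n, MemLp (X n) 2 P)
    (hρ : ‖ρ‖ < 1) (x : H) :
    Tendsto (fun n : ℕ => ∫ ω, ‖(n : ℝ)⁻¹ • ∑ k ∈ Finset.range n,
      (inner ℝ (X (1 + k) ω) x • X (1 + k) ω - ∫ ω, inner ℝ (X 0 ω) x • X 0 ω ∂P)‖ ∂P)
      atTop (𝓝 0) := by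
  have hf := (continuous_inner_smul_self x).measurable
  set v := ∫ ω, inner ℝ (X 0 ω) x • X 0 ω ∂P with hv
  have hiX : ∀ n, Integrable (fun ω => inner ℝ (X n ω) x • X n ω) P := fun n =>
    integrable_inner_smul_self (hL n) x
  have hiM : ∀ m n, Integrable (fun ω =>
      inner ℝ (movingAverage ρ ε m n ω) x • movingAverage ρ ε m n ω) P := fun m n =>
    integrable_inner_smul_self (hX.memLp_movingAverage hL m n) x
  refine tendsto_integral_norm_average (C := ∫ ω, ‖inner ℝ (X 0 ω) x • X 0 ω - v‖ ∂P)
    (fun k => (hiX _).sub (integrable_const v)) (fun k => (hX.integral_comp_process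
      (f := fun y => ‖inner ℝ y x • y - v‖) (by fun_prop) _).le) fun δ hδ => ?_
  set K := ‖x‖ * (3 * ∫ ω, ‖X 0 ω‖ ^ 2 ∂P) with hK
  have h0 : Tendsto (fun m : ℕ => ‖ρ‖ ^ m * K) atTop (𝓝 0) := by
    simpa using (tendsto_pow_atTop_nhds_zero_of_lt_one (norm_nonneg ρ) hρ).mul_const K
  -- The budget δ is split in three: truncation at m (uniform in time), the law of large numbers at
  -- fixed m, and the gap between the two means.
  obtain ⟨m, hm1, hm⟩ := ((h0.eventually (ge_mem_nhds (show 0 < δ / 3 by positivity))).and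
    (eventually_gt_atTop 0)).exists
  refine ⟨m, hm, fun r => ?_⟩
  set w := ∫ ω, inner ℝ (movingAverage ρ ε m 0 ω) x • movingAverage ρ ε m 0 ω ∂P with hw
  have hvw : ‖w - v‖ ≤ δ / 3 := by
    rw [norm_sub_rev, hv, hw, ← integral_sub (hiX 0) (hiM m 0)]
    exact (norm_integral_le_integral_norm _).trans
      ((hX.integral_norm_sub_movingAverage_le hL hρ x m 0).trans hm1)
  filter_upwards [(hX.tendsto_integral_movingAverage_average hL x m (1 + r)).eventually
    (ge_mem_nhds (show 0 < δ / 3 by positivity)), eventually_gt_atTop 0] with q hq hq0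
  have hq0' : (0 : ℝ) < q := by exact_mod_cast hq0
  have hcast : ∀ i : ℕ, (1 + ((r + m * i : ℕ) : ℤ)) = 1 + r + m * i := fun i => by push_cast; ring
  simp_rw [hcast]
  have hiS : Integrable (fun ω => (q : ℝ)⁻¹ • ∑ i ∈ Finset.range q,
      inner ℝ (movingAverage ρ ε m (1 + r + m * i) ω) x • movingAverage ρ ε m (1 + r + m * i) ω
        - w) P :=
    ((integrable_finsetSum _ fun i _ => hiM _ _).smul _).sub (integrable_const w)
  have hiT : ∀ n, Integrable (fun ω => ‖inner ℝ (X n ω) x • X n ω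
      - inner ℝ (movingAverage ρ ε m n ω) x • movingAverage ρ ε m n ω‖) P := fun n =>
    ((hiX n).sub (hiM m n)).norm
  have hiD : Integrable (fun ω => ∑ i ∈ Finset.range q, ‖inner ℝ (X (1 + r + m * i) ω) x •
      X (1 + r + m * i) ω - inner ℝ (movingAverage ρ ε m (1 + r + m * i) ω) x •
        movingAverage ρ ε m (1 + r + m * i) ω‖) P :=
    integrable_finsetSum _ fun i _ => hiT _
  have hpt : ∀ ω, ‖∑ i ∈ Finset.range q, (inner ℝ (X (1 + r + m * i) ω) x • X (1 + r + m * i) ω - v)‖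
      ≤ ∑ i ∈ Finset.range q, ‖inner ℝ (X (1 + r + m * i) ω) x •
      X (1 + r + m * i) ω - inner ℝ (movingAverage ρ ε m (1 + r + m * i) ω) x •
        movingAverage ρ ε m (1 + r + m * i) ω‖
      + q * ‖(q : ℝ)⁻¹ • ∑ i ∈ Finset.range q,
      inner ℝ (movingAverage ρ ε m (1 + r + m * i) ω) x • movingAverage ρ ε m (1 + r + m * i) ω
        - w‖ + q * (δ / 3) := by
    intro ω
    have h1 : ∑ i ∈ Finset.range q, (inner ℝ (X (1 + r + m * i) ω) x • X (1 + r + m * i) ω - v)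
        = ∑ i ∈ Finset.range q, (inner ℝ (X (1 + r + m * i) ω) x • X (1 + r + m * i) ω
          - inner ℝ (movingAverage ρ ε m (1 + r + m * i) ω) x •
            movingAverage ρ ε m (1 + r + m * i) ω)
        + (q : ℝ) • ((q : ℝ)⁻¹ • ∑ i ∈ Finset.range q,
      inner ℝ (movingAverage ρ ε m (1 + r + m * i) ω) x • movingAverage ρ ε m (1 + r + m * i) ω
        - w) + (q : ℝ) • (w - v) := by
      rw [smul_sub, smul_smul, mul_inv_cancel₀ hq0'.ne', one_smul, Finset.sum_sub_distrib,
        Finset.sum_sub_distrib, smul_sub]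
      simp only [Finset.sum_const, Finset.card_range, Nat.cast_smul_eq_nsmul]
      abel
    rw [h1]
    refine (norm_add_le _ _).trans (add_le_add ((norm_add_le _ _).trans (add_le_add
      (norm_sum_le _ _) ?_)) ?_)
    · rw [norm_smul, Real.norm_of_nonneg hq0'.le]
    · rw [norm_smul, Real.norm_of_nonneg hq0'.le]
      gcongr
  refine (integral_mono (integrable_finsetSum _ fun i _ => (hiX _).sub (integrable_const v)).norm
    ((hiD.add (hiS.norm.const_mul _)).add (integrable_const _)) hpt).trans ?_
  rw [integral_add' (hiD.add (hiS.norm.const_mul _)) (integrable_const _),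
    integral_add' hiD (hiS.norm.const_mul _), integral_const_mul, integral_const,
    integral_finsetSum _ fun i _ => hiT _]
  have h2 := Finset.sum_le_sum fun i (_ : i ∈ Finset.range q) =>
    (hX.integral_norm_sub_movingAverage_le hL hρ x m (1 + r + m * i)).trans hm1
  rw [Finset.sum_const, Finset.card_range, nsmul_eq_mul] at h2
  have h3 := mul_le_mul_of_nonneg_left hq hq0'.le
  simp only [probReal_univ, one_smul]
  linarith

end IsFAR1

end LawOfLargeNumbers

/-! ### Predictable integrands against independent noise: second moments. -/

section Noise

set_option linter.unusedSectionVars false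

/-- The integrands `Y k` are adapted to the filtration `F`, the noise `η k` is revealed at time
`k + 1` and is independent of `F k`. -/
structure IsPredictableNoise {Ω E G : Type*} [mΩ : MeasurableSpace Ω] [MeasurableSpace E]
    [MeasurableSpace G] (P : Measure Ω) (F : ℕ → MeasurableSpace Ω) (Y : ℕ → Ω → E)
    (η : ℕ → Ω → G) : Prop where
  mono : Monotone F
  le : ∀ k, F k ≤ mΩ
  adapted : ∀ k, Measurable[F k] (Y k)
  noise : ∀ k, Measurable[F (k + 1)] (η k)
  indep : ∀ k, Indep (F k) (MeasurableSpace.comap (η k) inferInstance) P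

namespace IsPredictableNoise

variable {Ω E G : Type*} [mΩ : MeasurableSpace Ω] [MeasurableSpace E] [MeasurableSpace G]
  {P : Measure Ω} {F : ℕ → MeasurableSpace Ω} {Y : ℕ → Ω → E} {η : ℕ → Ω → G}

theorem measurable_left (h : IsPredictableNoise P F Y η) (k : ℕ) : Measurable (Y k) :=
  (h.adapted k).mono (h.le k) le_rfl

theorem measurable_right (h : IsPredictableNoise P F Y η) (k : ℕ) : Measurable (η k) :=
  (h.noise k).mono (h.le _) le_rfl

theorem indepFun (h : IsPredictableNoise P F Y η) {k : ℕ} {α : Type*} [MeasurableSpace α]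
    {A : Ω → α} (hA : Measurable[F k] A) : IndepFun A (η k) P :=
  (IndepFun_iff_Indep _ _ _).2 (indep_of_indep_of_le_left (h.indep k) hA.comap_le)

theorem comp (h : IsPredictableNoise P F Y η) {E' G' : Type*} [MeasurableSpace E']
    [MeasurableSpace G'] {f : E → E'} {g : G → G'} (hf : Measurable f) (hg : Measurable g) :
    IsPredictableNoise P F (fun k ω => f (Y k ω)) (fun k ω => g (η k ω)) where
  mono := h.mono
  le := h.le
  adapted k := hf.comp (h.adapted k)
  noise k := hg.comp (h.noise k)
  indep k := indep_of_indep_of_le_right (h.indep k) (by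
    rw [show (fun ω => g (η k ω)) = g ∘ η k from rfl, ← MeasurableSpace.comap_comp]
    exact MeasurableSpace.comap_mono hg.comap_le)

end IsPredictableNoise

variable {H : Type*} [NormedAddCommGroup H] [InnerProductSpace ℝ H] [CompleteSpace H]

/-- The operator norm of a finite-rank operator is at most its Hilbert-Schmidt norm. -/
theorem norm_sum_tensor_sq_le {ι : Type*} (s : Finset ι) (y z : ι → H) :
    ‖∑ k ∈ s, tensor (y k) (z k)‖ ^ 2
      ≤ ∑ k ∈ s, ∑ l ∈ s, inner ℝ (y k) (y l) * inner ℝ (z k) (z l) := by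
  set K := ∑ k ∈ s, ∑ l ∈ s, inner ℝ (y k) (y l) * inner ℝ (z k) (z l) with hK
  obtain ⟨w, b, -⟩ := exists_hilbertBasis ℝ H
  -- Parseval for the adjoint: the summands are ‖S* b_j‖², whose total is the squared
  -- Hilbert-Schmidt norm of S.
  have hsum : HasSum (fun j => ‖∑ k ∈ s, inner ℝ (z k) (b j) • y k‖ ^ 2) K := by
    have h1 : ∀ j, ‖∑ k ∈ s, inner ℝ (z k) (b j) • y k‖ ^ 2
        = ∑ k ∈ s, ∑ l ∈ s, inner ℝ (y k) (y l) * (inner ℝ (z k) (b j) * inner ℝ (b j) (z l)) := by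
      intro j
      rw [← real_inner_self_eq_norm_sq, sum_inner]
      refine Finset.sum_congr rfl fun k _ => ?_
      rw [inner_sum]
      refine Finset.sum_congr rfl fun l _ => ?_
      rw [inner_smul_left, inner_smul_right, real_inner_comm (b j) (z l)]
      simp only [conj_trivial]
      ring
    simp_rw [h1]
    exact hasSum_sum fun k _ => hasSum_sum fun l _ =>
      (b.hasSum_inner_mul_inner (z k) (z l)).mul_left _
  have hK0 : 0 ≤ K := hsum.nonneg fun j => by positivity
  have hbound : ∀ h, ‖(∑ k ∈ s, tensor (y k) (z k)) h‖ ^ 2 ≤ K * ‖h‖ ^ 2 := by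
    intro h
    set S := (∑ k ∈ s, tensor (y k) (z k)) h with hS
    have h2 := b.hasSum_inner_mul_inner S S
    rw [real_inner_self_eq_norm_sq] at h2
    refine hasSum_le (fun j => ?_) h2 (hsum.mul_right (‖h‖ ^ 2))
    have h3 : inner ℝ S (b j) = inner ℝ (∑ k ∈ s, inner ℝ (z k) (b j) • y k) h := by
      simp only [hS, sum_apply, tensor_apply, sum_inner, inner_smul_left, conj_trivial]
      exact Finset.sum_congr rfl fun k _ => mul_comm _ _
    rw [real_inner_comm S (b j), h3, ← mul_pow, ← pow_two]
    refine sq_le_sq' ?_ ?_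
    · exact neg_le_of_abs_le (abs_real_inner_le_norm _ _)
    · exact real_inner_le_norm _ _
  have h4 : ‖∑ k ∈ s, tensor (y k) (z k)‖ ≤ √K := by
    refine ContinuousLinearMap.opNorm_le_bound _ (Real.sqrt_nonneg _) fun h => ?_
    refine le_of_sq_le_sq ?_ (by positivity)
    rw [mul_pow, Real.sq_sqrt hK0]
    exact hbound h
  calc _ ≤ √K ^ 2 := by gcongr
    _ = K := Real.sq_sqrt hK0

variable [SecondCountableTopology H] [MeasurableSpace H] [BorelSpace H] {Ω : Type*}
  [mΩ : MeasurableSpace Ω] {P : Measure Ω} [IsProbabilityMeasure P] {F : ℕ → MeasurableSpace Ω}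
  {Y η : ℕ → Ω → H}

namespace IsPredictableNoise

theorem integrable_sq_mul_sq (h : IsPredictableNoise P F Y η) (hY : ∀ k, MemLp (Y k) 2 P)
    (hη : ∀ k, MemLp (η k) 2 P) (k : ℕ) :
    Integrable (fun ω => ‖Y k ω‖ ^ 2 * ‖η k ω‖ ^ 2) P :=
  ((h.indepFun (h.adapted k)).comp (φ := fun y => ‖y‖ ^ 2) (ψ := fun y => ‖y‖ ^ 2)
    (by fun_prop) (by fun_prop)).integrable_mul ((hY k).integrable_norm_pow two_ne_zero)
    ((hη k).integrable_norm_pow two_ne_zero)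

theorem integral_sq_mul_sq (h : IsPredictableNoise P F Y η) (k : ℕ) :
    ∫ ω, ‖Y k ω‖ ^ 2 * ‖η k ω‖ ^ 2 ∂P = (∫ ω, ‖Y k ω‖ ^ 2 ∂P) * ∫ ω, ‖η k ω‖ ^ 2 ∂P :=
  ((h.indepFun (h.adapted k)).comp (φ := fun y => ‖y‖ ^ 2) (ψ := fun y => ‖y‖ ^ 2)
    (by fun_prop) (by fun_prop)).integral_fun_mul_eq_mul_integral
    ((h.measurable_left k).norm.pow_const 2).aestronglyMeasurable
    ((h.measurable_right k).norm.pow_const 2).aestronglyMeasurable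

/-- The later noise η_l is centred and independent of F_l, which carries the other three factors.
Integrability needs only second moments, since independence puts ‖Y_k‖‖η_k‖ in L². -/
theorem integrable_and_integral_cross (h : IsPredictableNoise P F Y η)
    (hY : ∀ k, MemLp (Y k) 2 P) (hη : ∀ k, MemLp (η k) 2 P) (h0 : ∀ k, ∫ ω, η k ω ∂P = 0)
    {k l : ℕ} (hkl : k < l) :
    Integrable (fun ω => inner ℝ (Y k ω) (Y l ω) * inner ℝ (η k ω) (η l ω)) P ∧
      ∫ ω, inner ℝ (Y k ω) (Y l ω) * inner ℝ (η k ω) (η l ω) ∂P = 0 := by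
  have hA : Measurable[F l] fun ω => inner ℝ (Y k ω) (Y l ω) • η k ω := by
    have h1 : Measurable[F l] (Y k) := (h.adapted k).mono (h.mono hkl.le) le_rfl
    have h2 : Measurable[F l] (η k) := (h.noise k).mono (h.mono hkl) le_rfl
    exact (h1.inner (h.adapted l)).smul h2
  have hL : MemLp (fun ω => ‖Y k ω‖ * ‖η k ω‖) 2 P := by
    refine (memLp_two_iff_integrable_sq
      ((h.measurable_left k).norm.mul (h.measurable_right k).norm).aestronglyMeasurable).2 ?_
    simpa [mul_pow] using h.integrable_sq_mul_sq hY hη k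
  have hAi : Integrable (fun ω => inner ℝ (Y k ω) (Y l ω) • η k ω) P := by
    refine (hL.integrable_mul (hY l).norm).mono'
      (hA.mono (h.le l) le_rfl).aestronglyMeasurable (Eventually.of_forall fun ω => ?_)
    rw [norm_smul]
    calc ‖inner ℝ (Y k ω) (Y l ω)‖ * ‖η k ω‖ ≤ (‖Y k ω‖ * ‖Y l ω‖) * ‖η k ω‖ := by
          gcongr; exact norm_inner_le_norm _ _
      _ = _ := by simp only [Pi.mul_apply]; ring
  have hηi : Integrable (η l) P := (hη l).integrable (by norm_num)
  have hind := h.indepFun hA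
  have h2 : Integrable (fun ω => inner ℝ (inner ℝ (Y k ω) (Y l ω) • η k ω) (η l ω)) P :=
    hind.integrable_bilin hAi hηi (innerSL ℝ)
  have h3 : ∫ ω, inner ℝ (inner ℝ (Y k ω) (Y l ω) • η k ω) (η l ω) ∂P = 0 := by
    have h4 := hind.integral_bilin hAi hηi (innerSL ℝ)
    rwa [h0 l, map_zero] at h4
  simp only [inner_smul_left, conj_trivial] at h2 h3
  exact ⟨h2, h3⟩

/-- The integrability and the expectation of the squared Hilbert-Schmidt norm of
`∑_{k<n} Y_k ⊗ η_k`. -/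
theorem integrable_and_integral_hilbertSchmidt (h : IsPredictableNoise P F Y η)
    (hY : ∀ k, MemLp (Y k) 2 P) (hη : ∀ k, MemLp (η k) 2 P) (h0 : ∀ k, ∫ ω, η k ω ∂P = 0) (n : ℕ) :
    Integrable (fun ω => ∑ k ∈ Finset.range n, ∑ l ∈ Finset.range n,
      inner ℝ (Y k ω) (Y l ω) * inner ℝ (η k ω) (η l ω)) P ∧
    ∫ ω, ∑ k ∈ Finset.range n, ∑ l ∈ Finset.range n,
      inner ℝ (Y k ω) (Y l ω) * inner ℝ (η k ω) (η l ω) ∂P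
      = ∑ k ∈ Finset.range n, (∫ ω, ‖Y k ω‖ ^ 2 ∂P) * ∫ ω, ‖η k ω‖ ^ 2 ∂P := by
  have key : ∀ k l, Integrable (fun ω => inner ℝ (Y k ω) (Y l ω) * inner ℝ (η k ω) (η l ω)) P ∧
      ∫ ω, inner ℝ (Y k ω) (Y l ω) * inner ℝ (η k ω) (η l ω) ∂P
        = if k = l then (∫ ω, ‖Y k ω‖ ^ 2 ∂P) * ∫ ω, ‖η k ω‖ ^ 2 ∂P else 0 := by
    intro k l
    rcases lt_trichotomy k l with hkl | rfl | hkl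
    · rw [if_neg hkl.ne]
      exact h.integrable_and_integral_cross hY hη h0 hkl
    · simp only [real_inner_self_eq_norm_sq, if_true]
      exact ⟨h.integrable_sq_mul_sq hY hη k, h.integral_sq_mul_sq k⟩
    · rw [if_neg hkl.ne']
      have h1 := h.integrable_and_integral_cross hY hη h0 hkl
      simpa only [real_inner_comm] using h1
  refine ⟨integrable_finsetSum _ fun k _ => integrable_finsetSum _ fun l _ => (key k l).1, ?_⟩
  rw [integral_finsetSum _ fun k _ => integrable_finsetSum _ fun l _ => (key k l).1]
  refine Finset.sum_congr rfl fun k hk => ?_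
  rw [integral_finsetSum _ fun l _ => (key k l).1, Finset.sum_congr rfl fun l _ => (key k l).2,
    Finset.sum_ite_eq, if_pos hk]

end IsPredictableNoise

end Noise

/-! ### Second-order comparison of characteristic functions with the Gaussian one. -/

section CharacteristicFunction

open Complex

variable {Ω : Type*} [mΩ : MeasurableSpace Ω] {P : Measure Ω} [IsProbabilityMeasure P]

/-- The distance between a characteristic function and that of the standard Gaussian law. -/
noncomputable def gaussGap (μ : Measure ℝ) (y : ℝ) : ℝ :=
  ‖charFun μ y - ((Real.exp (-(y ^ 2 / 2)) : ℝ) : ℂ)‖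

theorem gaussGap_zero (μ : Measure ℝ) [IsProbabilityMeasure μ] : gaussGap μ 0 = 0 := by
  simp [gaussGap]

theorem gaussGap_nonneg (μ : Measure ℝ) (y : ℝ) : 0 ≤ gaussGap μ y := norm_nonneg _

theorem continuous_gaussGap (μ : Measure ℝ) [IsProbabilityMeasure μ] :
    Continuous (gaussGap μ) := by
  unfold gaussGap
  have := continuous_charFun (μ := μ)
  fun_prop

theorem gaussGap_le_two (μ : Measure ℝ) [IsProbabilityMeasure μ] (y : ℝ) : gaussGap μ y ≤ 2 := by
  refine (norm_sub_le _ _).trans ?_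
  have h1 := norm_charFun_le_one (μ := μ) y
  have h2 : ‖((Real.exp (-(y ^ 2 / 2)) : ℝ) : ℂ)‖ ≤ 1 := by
    rw [norm_real, Real.norm_of_nonneg (Real.exp_pos _).le]
    exact Real.exp_le_one_iff.2 (by nlinarith [sq_nonneg y])
  linarith

/-- Both functions expand as 1 - y²/2 + o(y²). -/
theorem isLittleO_gaussGap {ξ : Ω → ℝ} (hξ : AEMeasurable ξ P) (h0 : ∫ ω, ξ ω ∂P = 0)
    (h1 : ∫ ω, ξ ω ^ 2 ∂P = 1) : gaussGap (P.map ξ) =o[𝓝 0] fun y => y ^ 2 := by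
  have h2 := taylor_charFun_two hξ h0 (by simpa using h1)
  have h3 : (fun y : ℝ => Real.exp (-(y ^ 2 / 2)) - (1 - y ^ 2 / 2)) =o[𝓝 0] fun y => y ^ 2 := by
    have h4 := (Real.hasDerivAt_exp 0).isLittleO
    simp only [Real.exp_zero, sub_zero, smul_eq_mul, mul_one] at h4
    have h5 : Tendsto (fun y : ℝ => -(y ^ 2 / 2)) (𝓝 0) (𝓝 0) := by
      have : Continuous fun y : ℝ => -(y ^ 2 / 2) := by fun_prop
      simpa using this.tendsto 0
    have h6 := h4.comp_tendsto h5
    refine (h6.congr_left fun y => ?_).trans_isBigO ?_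
    · simp only [Function.comp_apply]; ring
    · refine Asymptotics.IsBigO.of_bound 1 (Eventually.of_forall fun y => ?_)
      simp only [Function.comp_apply, norm_neg, norm_div, Real.norm_ofNat, one_mul]
      linarith [norm_nonneg (y ^ 2)]
  have h7 : (fun y : ℝ => ((Real.exp (-(y ^ 2 / 2)) - (1 - y ^ 2 / 2) : ℝ) : ℂ))
      =o[𝓝 0] fun y : ℝ => y ^ 2 :=
    Asymptotics.IsLittleO.of_norm_left (by simpa only [norm_real] using h3.norm_left)
  have h8 := (h2.sub (g := fun y : ℝ => y ^ 2) h7).norm_left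
  refine h8.congr_left fun y => ?_
  unfold gaussGap
  congr 1
  push_cast
  ring

/-- Near 0 this is the expansion; away from 0 the gap is at most 2. The global quadratic bound
provides the dominating function below. -/
theorem exists_gaussGap_le {ξ : Ω → ℝ} (hξ : AEMeasurable ξ P) (h0 : ∫ ω, ξ ω ∂P = 0)
    (h1 : ∫ ω, ξ ω ^ 2 ∂P = 1) : ∃ C, 0 ≤ C ∧ ∀ y, gaussGap (P.map ξ) y ≤ C * y ^ 2 := by
  have : IsProbabilityMeasure (P.map ξ) := Measure.isProbabilityMeasure_map hξ
  have h2 := (isLittleO_gaussGap hξ h0 h1).bound one_pos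
  obtain ⟨δ, hδ, h3⟩ := Metric.eventually_nhds_iff.1 h2
  refine ⟨1 + 2 / δ ^ 2, by positivity, fun y => ?_⟩
  by_cases hy : |y| < δ
  · have h4 := h3 (y := y) (by simpa using hy)
    rw [Real.norm_of_nonneg (gaussGap_nonneg _ _), Real.norm_of_nonneg (sq_nonneg y)] at h4
    refine h4.trans (mul_le_mul_of_nonneg_right ?_ (sq_nonneg y))
    have : 0 ≤ 2 / δ ^ 2 := by positivity
    linarith
  · refine (gaussGap_le_two _ y).trans ?_
    have h4 : δ ^ 2 ≤ y ^ 2 := by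
      rw [← sq_abs y]; exact pow_le_pow_left₀ hδ.le (not_lt.1 hy) 2
    have h5 : 2 = 2 / δ ^ 2 * δ ^ 2 := by field_simp
    calc (2 : ℝ) = 2 / δ ^ 2 * δ ^ 2 := h5
      _ ≤ 2 / δ ^ 2 * y ^ 2 := by gcongr
      _ ≤ (1 + 2 / δ ^ 2) * y ^ 2 := by nlinarith [sq_nonneg y]

/-- Plays the part of the Lindeberg condition: pointwise the integrand is n · o(1/n), dominated by C
t² Z². -/
theorem tendsto_mul_integral_gaussGap {ξ Z : Ω → ℝ} (hξ : AEMeasurable ξ P)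
    (h0 : ∫ ω, ξ ω ∂P = 0) (h1 : ∫ ω, ξ ω ^ 2 ∂P = 1) (hZ : MemLp Z 2 P) (t : ℝ) :
    Tendsto (fun n : ℕ => n * ∫ ω, gaussGap (P.map ξ) (t / √n * Z ω) ∂P) atTop (𝓝 0) := by
  have : IsProbabilityMeasure (P.map ξ) := Measure.isProbabilityMeasure_map hξ
  obtain ⟨C, hC, h2⟩ := exists_gaussGap_le hξ h0 h1
  have h3 : Tendsto (fun n : ℕ => ∫ ω, n * gaussGap (P.map ξ) (t / √n * Z ω) ∂P) atTop
      (𝓝 (∫ ω, (0 : ℝ) ∂P)) := by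
    refine tendsto_integral_of_dominated_convergence (fun ω => C * (t ^ 2 * Z ω ^ 2)) (fun n => ?_)
      (((hZ.integrable_sq).const_mul _).const_mul _) (fun n => Eventually.of_forall fun ω => ?_)
      (Eventually.of_forall fun ω => ?_)
    · exact ((continuous_gaussGap _).comp_aestronglyMeasurable (hZ.1.const_mul _)).const_mul _
    · rw [Real.norm_of_nonneg (mul_nonneg (Nat.cast_nonneg n) (gaussGap_nonneg _ _))]
      rcases Nat.eq_zero_or_pos n with rfl | hn
      · simp; positivity
      · have hn' : (0 : ℝ) < n := by exact_mod_cast hn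
        refine (mul_le_mul_of_nonneg_left (h2 _) hn'.le).trans (le_of_eq ?_)
        rw [mul_pow, div_pow, Real.sq_sqrt hn'.le]
        field_simp
    · have h4 : Tendsto (fun n : ℕ => t / √n * Z ω) atTop (𝓝 0) := by
        have : Tendsto (fun n : ℕ => t / √n) atTop (𝓝 0) :=
          (Real.tendsto_sqrt_atTop.comp tendsto_natCast_atTop_atTop).const_div_atTop t
        simpa using this.mul_const (Z ω)
      have h5 := (isLittleO_gaussGap hξ h0 h1).comp_tendsto h4
      have h6 : (fun n : ℕ => (n : ℝ) * gaussGap (P.map ξ) (t / √n * Z ω))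
          =o[atTop] fun n : ℕ => (n : ℝ) * (t / √n * Z ω) ^ 2 :=
        (Asymptotics.isBigO_refl (fun n : ℕ => (n : ℝ)) atTop).mul_isLittleO h5
      have h7 : (fun n : ℕ => (n : ℝ) * (t / √n * Z ω) ^ 2)
          =ᶠ[atTop] fun _ => t ^ 2 * Z ω ^ 2 := by
        filter_upwards [eventually_gt_atTop 0] with n hn
        have hn' : (0 : ℝ) < n := by exact_mod_cast hn
        rw [mul_pow, div_pow, Real.sq_sqrt hn'.le]
        field_simp
      exact (Asymptotics.isLittleO_one_iff ℝ).1 (h6.trans_isBigO (h7.isBigO.trans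
        (Asymptotics.isBigO_const_const _ (one_ne_zero : (1 : ℝ) ≠ 0) _)))
  simpa [integral_const_mul] using h3

/-- Conditioning on m in the form of Fubini for the product law of (G, y) and ξ. -/
theorem integral_mul_cexp_eq {Ω : Type*} {m mΩ : MeasurableSpace Ω} {P : Measure Ω}
    [IsProbabilityMeasure P] {ξ y : Ω → ℝ} {G : Ω → ℂ} (hm : m ≤ mΩ)
    (hG : Measurable[m] G) (hy : Measurable[m] y) (hξ : Measurable ξ)
    (hind : Indep m (MeasurableSpace.comap ξ inferInstance) P) {C : ℝ} (hC : ∀ ω, ‖G ω‖ ≤ C) :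
    ∫ ω, G ω * cexp (y ω * ξ ω * I) ∂P = ∫ ω, G ω * charFun (P.map ξ) (y ω) ∂P := by
  have : IsProbabilityMeasure (P.map ξ) := Measure.isProbabilityMeasure_map hξ.aemeasurable
  have hpair : Measurable[m] fun ω => (G ω, y ω) := hG.prodMk hy
  have hpair' : Measurable[mΩ] fun ω => (G ω, y ω) := hpair.mono hm le_rfl
  have hI : IndepFun (fun ω => (G ω, y ω)) ξ P :=
    (IndepFun_iff_Indep _ _ _).2 (indep_of_indep_of_le_left hind hpair.comap_le)
  have hmap := (indepFun_iff_map_prod_eq_prod_map_map hpair'.aemeasurable hξ.aemeasurable).1 hI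
  have hcont : Continuous fun p : (ℂ × ℝ) × ℝ => p.1.1 * cexp (p.1.2 * p.2 * I) := by fun_prop
  have hint : Integrable (fun ω => G ω * cexp (y ω * ξ ω * I)) P := by
    refine Integrable.of_bound (C := C) ?_ (Eventually.of_forall fun ω => ?_)
    · exact (hcont.measurable.comp (hpair'.prodMk hξ)).aestronglyMeasurable
    · rw [norm_mul, ← ofReal_mul, norm_exp_ofReal_mul_I, mul_one]
      exact hC ω
  have h1 : ∫ ω, G ω * cexp (y ω * ξ ω * I) ∂P
      = ∫ p, p.1.1 * cexp (p.1.2 * p.2 * I) ∂((P.map fun ω => (G ω, y ω)).prod (P.map ξ)) := by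
    rw [← hmap, integral_map (hpair'.prodMk hξ).aemeasurable hcont.aestronglyMeasurable]
  rw [h1, integral_prod, integral_map hpair'.aemeasurable]
  · refine integral_congr_ae (Eventually.of_forall fun ω => ?_)
    simp only [integral_const_mul, charFun_apply_real]
  · exact hcont.aestronglyMeasurable.integral_prod_right'
  · rw [← hmap, integrable_map_measure hcont.aestronglyMeasurable
      (hpair'.prodMk hξ).aemeasurable]
    exact hint

end CharacteristicFunction

/-! ### Martingale central limit theorem by a stopped exponential martingale. -/

section MartingaleCLT

set_option linter.unusedSectionVars false

open Complex

variable {Ω : Type*} [mΩ : MeasurableSpace Ω] {P : Measure Ω} [IsProbabilityMeasure P]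
  {F : ℕ → MeasurableSpace Ω} {Y η : ℕ → Ω → ℝ}

/-- The weights `u Y_k`, replaced by `0` once their sum of squares exceeds `B`. -/
noncomputable def stoppedWeight (Y : ℕ → Ω → ℝ) (u B : ℝ) (k : ℕ) (ω : Ω) : ℝ :=
  if ∑ i ∈ Finset.range (k + 1), (u * Y i ω) ^ 2 ≤ B then u * Y k ω else 0

theorem stoppedWeight_eq {u B : ℝ} {n : ℕ} {ω : Ω}
    (h : ∑ i ∈ Finset.range n, (u * Y i ω) ^ 2 ≤ B) {k : ℕ} (hk : k < n) :
    stoppedWeight Y u B k ω = u * Y k ω := by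
  refine if_pos (le_trans ?_ h)
  exact Finset.sum_le_sum_of_subset_of_nonneg (Finset.range_subset_range.2 hk)
    fun _ _ _ => sq_nonneg _

theorem stoppedWeight_sq_le (u B : ℝ) (k : ℕ) (ω : Ω) :
    stoppedWeight Y u B k ω ^ 2 ≤ (u * Y k ω) ^ 2 := by
  unfold stoppedWeight
  split_ifs
  · exact le_rfl
  · simpa using sq_nonneg (u * Y k ω)

/-- The stopping test at k already includes the k-th term, so a weight that would overshoot B is
itself replaced by 0. -/
theorem sum_stoppedWeight_sq_le {u B : ℝ} (hB : 0 ≤ B) (n : ℕ) (ω : Ω) :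
    ∑ k ∈ Finset.range n, stoppedWeight Y u B k ω ^ 2 ≤ B := by
  induction n with
  | zero => simpa
  | succ n ih =>
    by_cases h : ∑ i ∈ Finset.range (n + 1), (u * Y i ω) ^ 2 ≤ B
    · exact (Finset.sum_le_sum fun k _ => stoppedWeight_sq_le u B k ω).trans h
    · rw [Finset.sum_range_succ, stoppedWeight, if_neg h]
      simpa using ih

theorem measurable_stoppedWeight (h : IsPredictableNoise P F Y η) (u B : ℝ) (k : ℕ) :
    Measurable[F k] (stoppedWeight Y u B k) := by
  have hY : ∀ i ≤ k, Measurable[F k] (Y i) := fun i hi => (h.adapted i).mono (h.mono hi) le_rfl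
  have h1 : Measurable[F k] fun ω => ∑ i ∈ Finset.range (k + 1), (u * Y i ω) ^ 2 :=
    Finset.measurable_fun_sum _ fun i hi =>
      ((hY i (Nat.lt_succ_iff.1 (Finset.mem_range.1 hi))).const_mul u).pow_const 2
  exact Measurable.ite (measurableSet_le h1 measurable_const) ((hY k le_rfl).const_mul u)
    measurable_const

/-- The exponential martingale, up to small corrections, of the stopped weights. -/
noncomputable def expProd (Y η : ℕ → Ω → ℝ) (u B : ℝ) (n : ℕ) (ω : Ω) : ℂ :=
  cexp ((∑ k ∈ Finset.range n, stoppedWeight Y u B k ω * η k ω : ℝ) * I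
    + (∑ k ∈ Finset.range n, stoppedWeight Y u B k ω ^ 2 / 2 : ℝ))

theorem measurable_expProd (h : IsPredictableNoise P F Y η) (u B : ℝ) (n : ℕ) :
    Measurable[F n] (expProd Y η u B n) := by
  have hy : ∀ k ∈ Finset.range n, Measurable[F n] (stoppedWeight Y u B k) := fun k hk =>
    (measurable_stoppedWeight h u B k).mono (h.mono (Finset.mem_range.1 hk).le) le_rfl
  have hη : ∀ k ∈ Finset.range n, Measurable[F n] (η k) := fun k hk =>
    (h.noise k).mono (h.mono (Finset.mem_range.1 hk)) le_rfl
  have h1 : Measurable[F n] fun ω => ∑ k ∈ Finset.range n, stoppedWeight Y u B k ω * η k ω :=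
    Finset.measurable_fun_sum _ fun k hk => (hy k hk).mul (hη k hk)
  have h2 : Measurable[F n] fun ω => ∑ k ∈ Finset.range n, stoppedWeight Y u B k ω ^ 2 / 2 :=
    Finset.measurable_fun_sum _ fun k hk => ((hy k hk).pow_const 2).div_const 2
  exact measurable_exp.comp (((measurable_ofReal.comp h1).mul_const I).add
    (measurable_ofReal.comp h2))

theorem norm_expProd (u B : ℝ) (n : ℕ) (ω : Ω) : ‖expProd Y η u B n ω‖
    = Real.exp (∑ k ∈ Finset.range n, stoppedWeight Y u B k ω ^ 2 / 2) := by
  rw [expProd, norm_exp]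
  simp only [add_re, re_ofReal_mul, I_re, mul_zero, zero_add, ofReal_re]

theorem norm_expProd_le {u B : ℝ} (hB : 0 ≤ B) (n : ℕ) (ω : Ω) :
    ‖expProd Y η u B n ω‖ ≤ Real.exp (B / 2) := by
  rw [norm_expProd, ← Finset.sum_div]
  exact Real.exp_le_exp.2 (by linarith [sum_stoppedWeight_sq_le (Y := Y) (u := u) hB n ω])

theorem integrable_expProd (h : IsPredictableNoise P F Y η) (u : ℝ) {B : ℝ} (hB : 0 ≤ B)
    (n : ℕ) : Integrable (expProd Y η u B n) P :=
  Integrable.of_bound ((measurable_expProd h u B n).mono (h.le n) le_rfl).aestronglyMeasurable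
    _ (Eventually.of_forall fun ω => norm_expProd_le hB n ω)

/-- Integrating out η_n replaces exp(i y η_n) by its characteristic function at y; the compensator
subtracts exp(-y²/2), leaving the gap. A stopped weight is 0, where the gap vanishes. -/
theorem norm_integral_expProd_succ_sub_le (h : IsPredictableNoise P F Y η) (u : ℝ) {B : ℝ}
    (hB : 0 ≤ B) (n : ℕ) :
    ‖∫ ω, expProd Y η u B (n + 1) ω ∂P - ∫ ω, expProd Y η u B n ω ∂P‖
      ≤ Real.exp (B / 2) * ∫ ω, gaussGap (P.map (η n)) (u * Y n ω) ∂P := by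
  have : IsProbabilityMeasure (P.map (η n)) :=
    Measure.isProbabilityMeasure_map (h.measurable_right n).aemeasurable
  set y := stoppedWeight Y u B n with hy
  set G : Ω → ℂ := fun ω => expProd Y η u B n ω * (Real.exp (y ω ^ 2 / 2) : ℝ) with hG
  have hym : Measurable[F n] y := measurable_stoppedWeight h u B n
  have hGm : Measurable[F n] G := (measurable_expProd h u B n).mul
    (measurable_ofReal.comp (Real.measurable_exp.comp ((hym.pow_const 2).div_const 2)))
  have hGb : ∀ ω, ‖G ω‖ ≤ Real.exp (B / 2) := fun ω => by
    rw [hG, norm_mul, norm_expProd, norm_real, Real.norm_of_nonneg (Real.exp_pos _).le,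
      ← Real.exp_add]
    have h1 := sum_stoppedWeight_sq_le (Y := Y) (u := u) hB (n + 1) ω
    rw [Finset.sum_range_succ] at h1
    rw [← Finset.sum_div]
    exact Real.exp_le_exp.2 (by linarith)
  have h1 : ∀ ω, expProd Y η u B (n + 1) ω = G ω * cexp (y ω * η n ω * I) := fun ω => by
    simp only [hG, expProd, ofReal_exp, ← Complex.exp_add, Finset.sum_range_succ, ← hy]
    congr 1
    push_cast
    ring
  have h2 : ∀ ω, expProd Y η u B n ω = G ω * (Real.exp (-(y ω ^ 2 / 2)) : ℝ) := fun ω => by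
    simp only [hG]
    rw [mul_assoc, ← ofReal_mul, ← Real.exp_add, add_neg_cancel, Real.exp_zero, ofReal_one, mul_one]
  have hYm := h.measurable_left n
  have hym' : Measurable y := hym.mono (h.le n) le_rfl
  have hGm' : Measurable G := hGm.mono (h.le n) le_rfl
  have hGap : ∀ z : Ω → ℝ, Measurable z →
      Integrable (fun ω => gaussGap (P.map (η n)) (z ω)) P := fun z hz =>
    Integrable.of_bound ((continuous_gaussGap _).measurable.comp hz).aestronglyMeasurable 2
      (Eventually.of_forall fun ω => by
        rw [Real.norm_of_nonneg (gaussGap_nonneg _ _)]; exact gaussGap_le_two _ _)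
  have hφ : Integrable (fun ω => G ω * charFun (P.map (η n)) (y ω)) P := by
    refine Integrable.of_bound
      (hGm'.mul (continuous_charFun.measurable.comp hym')).aestronglyMeasurable (Real.exp (B / 2))
      (Eventually.of_forall fun ω => ?_)
    rw [norm_mul]
    exact (mul_le_mul (hGb ω) (norm_charFun_le_one _) (norm_nonneg _)
      (Real.exp_pos _).le).trans (mul_one _).le
  have hW := integrable_expProd h u hB n
  rw [integral_congr_ae (Eventually.of_forall h1), integral_mul_cexp_eq (h.le n) hGm hym
    (h.measurable_right n) (h.indep n) hGb, ← integral_sub hφ hW, ← integral_const_mul]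
  refine norm_integral_le_of_norm_le ((hGap _ (hYm.const_mul u)).const_mul _)
    (Eventually.of_forall fun ω => ?_)
  rw [h2 ω, ← mul_sub, norm_mul]
  refine mul_le_mul (hGb ω) ?_ (norm_nonneg _) (Real.exp_pos _).le
  change gaussGap (P.map (η n)) (y ω) ≤ _
  rw [hy, stoppedWeight]
  split_ifs
  · exact le_rfl
  · rw [gaussGap_zero]
    exact gaussGap_nonneg _ _

theorem norm_integral_expProd_sub_one_le (h : IsPredictableNoise P F Y η)
    (hY : ∀ k, IdentDistrib (Y k) (Y 0) P P) (hη : ∀ k, IdentDistrib (η k) (η 0) P P)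
    (u : ℝ) {B : ℝ} (hB : 0 ≤ B) (n : ℕ) :
    ‖∫ ω, expProd Y η u B n ω ∂P - 1‖
      ≤ Real.exp (B / 2) * (n * ∫ ω, gaussGap (P.map (η 0)) (u * Y 0 ω) ∂P) := by
  have : IsProbabilityMeasure (P.map (η 0)) :=
    Measure.isProbabilityMeasure_map (h.measurable_right 0).aemeasurable
  induction n with
  | zero => simp [expProd]
  | succ n ih =>
    have h1 := norm_integral_expProd_succ_sub_le h u hB n
    have h2 : ∫ ω, gaussGap (P.map (η 0)) (u * Y n ω) ∂P
        = ∫ ω, gaussGap (P.map (η 0)) (u * Y 0 ω) ∂P :=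
      ((hY n).comp ((continuous_gaussGap (P.map (η 0))).measurable.comp
        (measurable_const_mul u))).integral_eq
    rw [(hη n).map_eq, h2] at h1
    refine (norm_sub_le_norm_sub_add_norm_sub _ (∫ ω, expProd Y η u B n ω ∂P) _).trans ?_
    refine (add_le_add h1 ih).trans (le_of_eq ?_)
    push_cast
    ring

/-- A central limit theorem for martingales with stationary integrands obeying a law of large
numbers, in terms of characteristic functions. -/
theorem tendsto_integral_cexp (h : IsPredictableNoise P F Y η)
    (hY : ∀ k, IdentDistrib (Y k) (Y 0) P P) (hη : ∀ k, IdentDistrib (η k) (η 0) P P)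
    (hY2 : MemLp (Y 0) 2 P) (h0 : ∫ ω, η 0 ω ∂P = 0) (h1 : ∫ ω, η 0 ω ^ 2 ∂P = 1)
    {lam : ℝ} (hlam : 0 ≤ lam)
    (hL : SmallInProb P fun n ω => |(n : ℝ)⁻¹ * ∑ k ∈ Finset.range n, Y k ω ^ 2 - lam|) (t : ℝ) :
    Tendsto (fun n : ℕ => ∫ ω, cexp ((t / √n * ∑ k ∈ Finset.range n, Y k ω * η k ω : ℝ) * I) ∂P)
      atTop (𝓝 (Real.exp (-(t ^ 2 * lam / 2)) : ℝ)) := by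
  set s := t ^ 2 * lam / 2 with hs
  -- The limiting sum of squares is t²λ, so with a margin of 1 the stopping is inactive on the good
  -- event.
  set B := t ^ 2 * lam + 1 with hB
  have hs0 : 0 ≤ s := by positivity
  have hB0 : 0 ≤ B := by positivity
  have hgap : Tendsto (fun n : ℕ => Real.exp (B / 2) *
      (n * ∫ ω, gaussGap (P.map (η 0)) (t / √n * Y 0 ω) ∂P)) atTop (𝓝 0) := by
    simpa using (tendsto_mul_integral_gaussGap (h.measurable_right 0).aemeasurable h0 h1 hY2
      t).const_mul (Real.exp (B / 2))
  rw [Metric.tendsto_atTop']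
  intro r hr
  -- a neighbourhood of the limiting variance on which the exponential is controlled
  obtain ⟨d, hd, hexp⟩ : ∃ d, 0 < d ∧ ∀ z : ℝ, |z| < d → |1 - Real.exp z| < r / 4 := by
    have h2 := Metric.continuousAt_iff.1 (Real.continuous_exp.continuousAt (x := 0)) (r / 4)
      (by positivity)
    obtain ⟨d, hd, h3⟩ := h2
    refine ⟨d, hd, fun z hz => ?_⟩
    have := h3 (x := z) (by simpa using hz)
    rwa [Real.exp_zero, dist_comm, Real.dist_eq] at this
  have hd' : 0 < min d 1 := by positivity
  -- The integrand is at most 5 on the bad event, which thus contributes 5 · r/20 = r/4. The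
  -- denominator t² + 1 covers t = 0.
  have hL' := hL (min d 1 / (t ^ 2 + 1)) (by positivity) (r / 20) (by positivity)
  obtain ⟨N, hN⟩ := eventually_atTop.1 ((hgap.eventually (gt_mem_nhds (show 0 < r / 4 by
    positivity))).and (hL'.and (eventually_gt_atTop 0)))
  refine ⟨N, fun n hn => ?_⟩
  obtain ⟨hn1, hn2, hn3⟩ := hN n hn.le
  have hn' : (0 : ℝ) < n := by exact_mod_cast hn3
  set u := t / √n with hu
  have hu2 : u ^ 2 = t ^ 2 * (n : ℝ)⁻¹ := by rw [hu, div_pow, Real.sq_sqrt hn'.le, div_eq_mul_inv]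
  set bad : Set Ω := {ω | min d 1 / (t ^ 2 + 1)
    < |(n : ℝ)⁻¹ * ∑ k ∈ Finset.range n, Y k ω ^ 2 - lam|} with hbad
  have hYm := h.measurable_left
  have hηm := h.measurable_right
  have hbadm : MeasurableSet bad := by
    refine measurableSet_lt measurable_const ?_
    have h2 : Measurable fun ω => ∑ k ∈ Finset.range n, Y k ω ^ 2 :=
      Finset.measurable_fun_sum _ fun k _ => (hYm k).pow_const 2
    exact continuous_abs.measurable.comp ((h2.const_mul _).sub_const _)
  set M : Ω → ℂ := fun ω => cexp ((u * ∑ k ∈ Finset.range n, Y k ω * η k ω : ℝ) * I) with hM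
  set W := expProd Y η u B n with hW
  have hWi : Integrable W P := integrable_expProd h u hB0 n
  have hMi : Integrable M P := by
    have h2 : Measurable fun ω => ∑ k ∈ Finset.range n, Y k ω * η k ω :=
      Finset.measurable_fun_sum _ fun k _ => (hYm k).mul (hηm k)
    refine Integrable.of_bound (C := 1) (measurable_exp.comp
      ((measurable_ofReal.comp (h2.const_mul u)).mul_const I)).aestronglyMeasurable
      (Eventually.of_forall fun ω => ?_)
    rw [hM, norm_exp_ofReal_mul_I]
  have hsum : ∀ ω, ∑ k ∈ Finset.range n, (u * Y k ω) ^ 2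
      = t ^ 2 * ((n : ℝ)⁻¹ * ∑ k ∈ Finset.range n, Y k ω ^ 2) := fun ω => by
    simp only [mul_pow, hu2, ← Finset.mul_sum]
    ring
  have hgood : ∀ ω ∉ bad, ‖M ω - (Real.exp (-s) : ℝ) * W ω‖ ≤ r / 4 := by
    intro ω hω
    simp only [hbad, Set.mem_ofPred_eq, not_lt] at hω
    set A := (n : ℝ)⁻¹ * ∑ k ∈ Finset.range n, Y k ω ^ 2
    have h2 : |t ^ 2 * A - t ^ 2 * lam| ≤ min d 1 := by
      rw [← mul_sub, abs_mul, abs_of_nonneg (sq_nonneg t)]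
      rw [le_div_iff₀ (by positivity)] at hω
      nlinarith [abs_nonneg (A - lam)]
    have h3 : ∑ k ∈ Finset.range n, (u * Y k ω) ^ 2 ≤ B := by
      rw [hsum]
      have := (le_abs_self _).trans (h2.trans (min_le_right _ _))
      linarith
    have h4 : ∀ k ∈ Finset.range n, stoppedWeight Y u B k ω = u * Y k ω := fun k hk =>
      stoppedWeight_eq h3 (Finset.mem_range.1 hk)
    -- Off the bad event no weight is stopped and the compensator is explicit.
    have h5 : W ω = M ω * (Real.exp (t ^ 2 * A / 2) : ℝ) := by
      have h6 : ∑ k ∈ Finset.range n, stoppedWeight Y u B k ω * η k ω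
          = u * ∑ k ∈ Finset.range n, Y k ω * η k ω := by
        rw [Finset.mul_sum]
        exact Finset.sum_congr rfl fun k hk => by rw [h4 k hk, mul_assoc]
      have h7 : ∑ k ∈ Finset.range n, stoppedWeight Y u B k ω ^ 2 / 2 = t ^ 2 * A / 2 := by
        rw [← Finset.sum_div, ← hsum]
        exact congrArg (· / 2) (Finset.sum_congr rfl fun k hk => by rw [h4 k hk])
      rw [hW, expProd, Complex.exp_add, h6, h7, ← ofReal_exp]
    have h6 : M ω - (Real.exp (-s) : ℝ) * W ω
        = M ω * ((1 - Real.exp (t ^ 2 * A / 2 - s) : ℝ) : ℂ) := by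
      rw [h5, sub_eq_add_neg (t ^ 2 * A / 2), Real.exp_add]
      push_cast
      ring
    rw [h6, norm_mul, hM, norm_exp_ofReal_mul_I, one_mul, norm_real]
    refine (hexp _ ?_).le
    have h7 : t ^ 2 * A / 2 - s = (t ^ 2 * A - t ^ 2 * lam) / 2 := by rw [hs]; ring
    rw [h7, abs_div, abs_two]
    have := h2.trans (min_le_left _ _)
    linarith
  have hbadb : ∀ ω, ‖M ω - (Real.exp (-s) : ℝ) * W ω‖ ≤ 5 := by
    intro ω
    refine (norm_sub_le _ _).trans ?_
    rw [hM, norm_exp_ofReal_mul_I, norm_mul, norm_real, Real.norm_of_nonneg (Real.exp_pos _).le]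
    have h2 := norm_expProd_le (Y := Y) (η := η) (u := u) hB0 n ω
    have h3 : Real.exp (-s) * Real.exp (B / 2) ≤ 4 := by
      rw [← Real.exp_add]
      have h4 : -s + B / 2 ≤ 1 := by rw [hs, hB]; linarith
      refine (Real.exp_le_exp.2 h4).trans ?_
      linarith [Real.exp_one_lt_d9]
    have h4 := mul_le_mul_of_nonneg_left h2 (Real.exp_pos (-s)).le
    linarith
  have hWc : Integrable (fun ω => ((Real.exp (-s) : ℝ) : ℂ) * W ω) P := hWi.const_mul _
  have h8 : ‖∫ ω, M ω ∂P - (Real.exp (-s) : ℝ) * ∫ ω, W ω ∂P‖ ≤ r / 4 + 5 * (r / 20) := by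
    rw [← integral_const_mul, ← integral_sub hMi hWc]
    have h9 : Integrable (fun ω => r / 4 + bad.indicator (fun _ => (5 : ℝ)) ω) P :=
      (integrable_const _).add ((integrable_const _).indicator hbadm)
    refine (norm_integral_le_of_norm_le h9 (Eventually.of_forall fun ω => ?_)).trans ?_
    · by_cases hω : ω ∈ bad
      · rw [Set.indicator_of_mem hω]
        linarith [hbadb ω]
      · rw [Set.indicator_of_notMem hω]
        linarith [hgood ω hω]
    · rw [integral_add (integrable_const _) ((integrable_const _).indicator hbadm),
        integral_indicator_const _ hbadm, integral_const]
      simp only [probReal_univ, smul_eq_mul]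
      have h10 : P.real bad ≤ r / 20 := ENNReal.toReal_le_of_le_ofReal (by positivity) hn2
      linarith
  have h11 := norm_integral_expProd_sub_one_le h hY hη u hB0 n
  rw [dist_eq_norm]
  have h12 : ∫ ω, M ω ∂P - (Real.exp (-s) : ℝ)
      = (∫ ω, M ω ∂P - (Real.exp (-s) : ℝ) * ∫ ω, W ω ∂P)
        + (Real.exp (-s) : ℝ) * (∫ ω, W ω ∂P - 1) := by ring
  rw [h12]
  refine lt_of_le_of_lt (norm_add_le _ _) ?_
  rw [norm_mul, norm_real, Real.norm_of_nonneg (Real.exp_pos _).le]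
  have h13 : Real.exp (-s) ≤ 1 := Real.exp_le_one_iff.2 (by linarith)
  have h14 := mul_le_mul h13 h11 (norm_nonneg _) zero_le_one
  linarith

end MartingaleCLT

/-! ### The covariance operator: symmetry, dense range, finite trace. -/

section Covariance

set_option linter.unusedSectionVars false

variable {H : Type*} [NormedAddCommGroup H] [InnerProductSpace ℝ H] [CompleteSpace H]
  [SecondCountableTopology H] [MeasurableSpace H]
  [BorelSpace H] {Ω : Type*} [mΩ : MeasurableSpace Ω] {P : Measure Ω} [IsProbabilityMeasure P]
  {ρ : H →L[ℝ] H} {X ε : ℤ → Ω → H}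

theorem norm_tensor_le (u v : H) : ‖tensor u v‖ ≤ ‖u‖ * ‖v‖ := by
  refine ContinuousLinearMap.opNorm_le_bound _ (by positivity) fun h => ?_
  rw [tensor_apply, norm_smul]
  calc ‖inner ℝ u h‖ * ‖v‖ ≤ (‖u‖ * ‖h‖) * ‖v‖ := by gcongr; exact norm_inner_le_norm _ _
    _ = _ := by ring

theorem integrable_tensor_self {Y : Ω → H} (hY : MemLp Y 2 P) :
    Integrable (fun ω => tensor (Y ω) (Y ω)) P := by
  have hc : Continuous fun y : H => tensor y y := by
    have h1 : ∀ y : H, tensor y y = ContinuousLinearMap.smulRightL ℝ H H (innerSL ℝ y) y :=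
      fun y => by ext h; simp [tensor_apply]
    simp_rw [h1]
    exact (ContinuousLinearMap.smulRightL ℝ H H).continuous₂.comp
      ((innerSL ℝ).continuous.prodMk continuous_id)
  refine (hY.integrable_norm_pow two_ne_zero).mono' (hc.comp_aestronglyMeasurable hY.1)
    (Eventually.of_forall fun ω => ?_)
  rw [pow_two]
  exact norm_tensor_le _ _

namespace IsFAR1

theorem covOp_apply (hX : IsFAR1 P ρ X ε) (hL : ∀ n, MemLp (X n) 2 P) (h : H) :
    covOp P X h = ∫ ω, inner ℝ (X 0 ω) h • X 0 ω ∂P := by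
  rw [covOp, ContinuousLinearMap.integral_apply (integrable_tensor_self (hL 1))]
  simp_rw [tensor_apply]
  exact hX.integral_comp_process (f := fun y => inner ℝ y h • y) (by fun_prop) 1

theorem inner_covOp (hX : IsFAR1 P ρ X ε) (hL : ∀ n, MemLp (X n) 2 P) (x y : H) :
    inner ℝ (covOp P X x) y = ∫ ω, inner ℝ (X 0 ω) x * inner ℝ (X 0 ω) y ∂P := by
  rw [hX.covOp_apply hL, real_inner_comm, ← integral_inner (integrable_inner_smul_self (hL 0) x)]
  refine integral_congr_ae (Eventually.of_forall fun ω => ?_)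
  simp only [inner_smul_right, real_inner_comm]

theorem inner_covOp_self (hX : IsFAR1 P ρ X ε) (hL : ∀ n, MemLp (X n) 2 P) (x : H) :
    inner ℝ (covOp P X x) x = ∫ ω, inner ℝ (X 0 ω) x ^ 2 ∂P := by
  rw [hX.inner_covOp hL]
  simp_rw [pow_two]

theorem inner_covOp_comm (hX : IsFAR1 P ρ X ε) (hL : ∀ n, MemLp (X n) 2 P) (x y : H) :
    inner ℝ (covOp P X x) y = inner ℝ (covOp P X y) x := by
  rw [hX.inner_covOp hL, hX.inner_covOp hL]
  simp_rw [mul_comm]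

theorem inner_covOp_self_nonneg (hX : IsFAR1 P ρ X ε) (hL : ∀ n, MemLp (X n) 2 P) (x : H) :
    0 ≤ inner ℝ (covOp P X x) x := by
  rw [hX.inner_covOp_self hL]
  exact integral_nonneg fun _ => sq_nonneg _

theorem inner_covOp_sq_le (hX : IsFAR1 P ρ X ε) (hL : ∀ n, MemLp (X n) 2 P) (x y : H) :
    inner ℝ (covOp P X x) y ^ 2 ≤ inner ℝ (covOp P X x) x * inner ℝ (covOp P X y) y := by
  have h1 : ∀ t : ℝ, 0 ≤ inner ℝ (covOp P X y) y * (t * t) + 2 * inner ℝ (covOp P X x) y * t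
      + inner ℝ (covOp P X x) x := fun t => by
    have h2 := hX.inner_covOp_self_nonneg hL (x + t • y)
    rw [map_add, map_smul, inner_add_left, inner_add_right, inner_add_right, inner_smul_left,
      inner_smul_left, inner_smul_right, inner_smul_right, hX.inner_covOp_comm hL y x] at h2
    simp only [conj_trivial] at h2
    linarith
  have h3 := discrim_le_zero h1
  rw [discrim] at h3
  nlinarith

/-- For a symmetric operator the orthogonal complement of the range lies in the kernel. -/
theorem denseRange_covOp (hX : IsFAR1 P ρ X ε) (hL : ∀ n, MemLp (X n) 2 P)
    (hker : ∀ x : H, covOp P X x = 0 → x = 0) : DenseRange (covOp P X) := by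
  have h1 : (LinearMap.range (covOp P X).toLinearMap).topologicalClosure = ⊤ := by
    rw [Submodule.topologicalClosure_eq_top_iff, Submodule.eq_bot_iff]
    intro y hy
    refine hker y (inner_self_eq_zero (𝕜 := ℝ).1 ?_)
    rw [hX.inner_covOp_comm hL]
    exact (Submodule.mem_orthogonal _ _).1 hy _ ⟨_, rfl⟩
  have h2 := Submodule.dense_iff_topologicalClosure_eq_top.2 h1
  rw [LinearMap.coe_range] at h2
  exact h2

/-- Bessel's inequality inside the expectation: Γ has finite trace. -/
theorem sum_inner_covOp_le (hX : IsFAR1 P ρ X ε) (hL : ∀ n, MemLp (X n) 2 P) {e : ℕ → H}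
    (he : Orthonormal ℝ e) (n : ℕ) :
    ∑ j ∈ Finset.range n, inner ℝ (covOp P X (e j)) (e j) ≤ ∫ ω, ‖X 0 ω‖ ^ 2 ∂P := by
  have hi : ∀ x, Integrable (fun ω => inner ℝ (X 0 ω) x ^ 2) P := fun x =>
    ((hL 0).inner_const x).integrable_sq
  rw [Finset.sum_congr rfl fun j _ => hX.inner_covOp_self hL (e j),
    ← integral_finsetSum _ fun j _ => hi _]
  refine integral_mono (integrable_finsetSum _ fun j _ => hi _)
    ((hL 0).integrable_norm_pow two_ne_zero) fun ω => ?_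
  have h1 := he.sum_inner_products_le (s := Finset.range n) (X 0 ω)
  refine le_trans (le_of_eq (Finset.sum_congr rfl fun j _ => ?_)) h1
  rw [real_inner_comm, Real.norm_eq_abs, sq_abs]

/-- In infinite dimension, the covariance operator has directions along which its norm is negligible
with respect to the standard deviation. -/
theorem exists_norm_covOp_sq_le (hX : IsFAR1 P ρ X ε) (hL : ∀ n, MemLp (X n) 2 P)
    (hker : ∀ x : H, covOp P X x = 0 → x = 0) {e : ℕ → H} (he : Orthonormal ℝ e) {θ : ℝ}
    (hθ : 0 < θ) : ∃ a : H, 0 < inner ℝ (covOp P X a) a ∧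
      ‖covOp P X a‖ ^ 2 ≤ θ * inner ℝ (covOp P X a) a := by
  by_contra! hcon
  set Γ := covOp P X with hΓ
  -- If no such direction exists, Cauchy-Schwarz for the form ⟪Γ ·, ·⟫ gives Γ ≥ θ on the range of
  -- Γ, hence everywhere by density, against the finite trace.
  have h1 : ∀ a, θ * ‖Γ a‖ ^ 2 ≤ inner ℝ (Γ (Γ a)) (Γ a) := by
    intro a
    have hcs := hX.inner_covOp_sq_le hL a (Γ a)
    rw [← hΓ, real_inner_self_eq_norm_sq] at hcs
    have hp := hX.inner_covOp_self_nonneg hL (Γ a)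
    rw [← hΓ] at hp
    rcases eq_or_lt_of_le (norm_nonneg (Γ a)) with h0 | h0
    · rw [← h0]; simpa using hp
    · have hpos : 0 < inner ℝ (Γ a) a := by
        refine lt_of_le_of_ne (hX.inner_covOp_self_nonneg hL a) fun h => ?_
        rw [← h, zero_mul] at hcs
        have : 0 < (‖Γ a‖ ^ 2) ^ 2 := by positivity
        linarith
      have h2 := hcon a hpos
      by_contra! h3
      have h4 : inner ℝ (Γ a) a * inner ℝ (Γ (Γ a)) (Γ a)
          ≤ inner ℝ (Γ a) a * (θ * ‖Γ a‖ ^ 2) := mul_le_mul_of_nonneg_left h3.le hpos.le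
      have h5 : θ * inner ℝ (Γ a) a * ‖Γ a‖ ^ 2 < ‖Γ a‖ ^ 2 * ‖Γ a‖ ^ 2 :=
        mul_lt_mul_of_pos_right h2 (by positivity)
      nlinarith
  have h2 : ∀ b, θ * ‖b‖ ^ 2 ≤ inner ℝ (Γ b) b := by
    intro b
    refine (hX.denseRange_covOp hL hker).induction_on (p := fun b => θ * ‖b‖ ^ 2 ≤ inner ℝ (Γ b) b)
      b ?_ h1
    exact isClosed_le (by fun_prop) (by fun_prop)
  obtain ⟨n, hn⟩ := exists_nat_gt ((∫ ω, ‖X 0 ω‖ ^ 2 ∂P) / θ)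
  have h3 := hX.sum_inner_covOp_le hL he n
  have h4 : n * θ ≤ ∑ j ∈ Finset.range n, inner ℝ (Γ (e j)) (e j) := by
    calc n * θ = ∑ j ∈ Finset.range n, θ * ‖e j‖ ^ 2 := by simp [he.1]
      _ ≤ _ := Finset.sum_le_sum fun j _ => h2 (e j)
  rw [div_lt_iff₀ hθ] at hn
  linarith

/-- If every coordinate of the noise vanished, X_1 = ρ X_0 would contract the stationary second
moment, forcing X = 0 and Γ = 0 against injectivity. -/
theorem exists_integral_inner_noise_eq_one (hX : IsFAR1 P ρ X ε) (hL : ∀ n, MemLp (X n) 2 P)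
    (hε : MemLp (ε 0) 2 P) (hρ : ‖ρ‖ < 1) (hker : ∀ x : H, covOp P X x = 0 → x = 0)
    [Nontrivial H] : ∃ f : H, ∫ ω, inner ℝ (ε 0 ω) f ^ 2 ∂P = 1 := by
  by_cases h0 : ∀ c : H, (fun ω => inner ℝ c (ε 0 ω)) =ᵐ[P] 0
  · exfalso
    have h1 := (hX.identDistrib_noise 1).symm.ae_snd (p := fun x => x = 0) measurableSet_eq
      (ae_eq_zero_of_forall_inner h0)
    have hi : ∀ n, Integrable (fun ω => ‖X n ω‖ ^ 2) P := fun n =>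
      (hL n).integrable_norm_pow two_ne_zero
    have h2 : ∫ ω, ‖X 1 ω‖ ^ 2 ∂P ≤ ∫ ω, ‖ρ‖ ^ 2 * ‖X 0 ω‖ ^ 2 ∂P := by
      refine integral_mono_ae (hi 1) ((hi 0).const_mul _) ?_
      filter_upwards [h1, hX.recursion 1] with ω h3 h4
      rw [h4, h3, add_zero, ← mul_pow, sub_self]
      exact pow_le_pow_left₀ (norm_nonneg _) (ρ.le_opNorm _) 2
    rw [hX.integral_comp_process (f := fun y => ‖y‖ ^ 2) (by fun_prop) 1, integral_const_mul] at h2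
    have h3 : ‖ρ‖ ^ 2 < 1 := by nlinarith [norm_nonneg ρ]
    have h4 : ∫ ω, ‖X 0 ω‖ ^ 2 ∂P = 0 := by
      have : 0 ≤ ∫ ω, ‖X 0 ω‖ ^ 2 ∂P := integral_nonneg fun _ => sq_nonneg _
      nlinarith
    rw [integral_eq_zero_iff_of_nonneg (fun _ => sq_nonneg _) (hi 0)] at h4
    obtain ⟨x, hx⟩ := exists_ne (0 : H)
    refine hx (hker x ?_)
    rw [hX.covOp_apply hL]
    refine integral_eq_zero_of_ae ?_
    filter_upwards [h4] with ω hω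
    have : X 0 ω = 0 := by simpa using hω
    simp [this]
  · push Not at h0
    obtain ⟨c, hc⟩ := h0
    have hi : Integrable (fun ω => inner ℝ (ε 0 ω) c ^ 2) P := (hε.inner_const c).integrable_sq
    have h1 : 0 < ∫ ω, inner ℝ (ε 0 ω) c ^ 2 ∂P := by
      refine lt_of_le_of_ne (integral_nonneg fun _ => sq_nonneg _) fun h => hc ?_
      rw [eq_comm, integral_eq_zero_iff_of_nonneg (fun _ => sq_nonneg _) hi] at h
      filter_upwards [h] with ω hω
      rw [real_inner_comm]
      simpa using hω
    set v := ∫ ω, inner ℝ (ε 0 ω) c ^ 2 ∂P with hv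
    refine ⟨(√v)⁻¹ • c, ?_⟩
    simp_rw [inner_smul_right, mul_pow]
    rw [integral_const_mul, ← hv, inv_pow, Real.sq_sqrt h1.le, inv_mul_cancel₀ h1.ne']

end IsFAR1

end Covariance

/-! ### Stochastic orders of the empirical operators. -/

section Asymptotics

set_option linter.unusedSectionVars false

variable {H : Type*} [NormedAddCommGroup H] [InnerProductSpace ℝ H] [CompleteSpace H]
  [SecondCountableTopology H] [MeasurableSpace H]
  [BorelSpace H] {Ω : Type*} [mΩ : MeasurableSpace Ω] {P : Measure Ω} [IsProbabilityMeasure P]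
  {ρ : H →L[ℝ] H} {X ε : ℤ → Ω → H}

namespace IsFAR1

/-- Time is shifted so that index k pairs X_{1+k} with ε_{2+k}, matching the k-th summand of the
noise operator. -/
theorem exists_isPredictableNoise (hX : IsFAR1 P ρ X ε) (hρ : ‖ρ‖ < 1) :
    ∃ (F : ℕ → MeasurableSpace Ω) (Y : ℕ → Ω → H),
      IsPredictableNoise P F Y (fun k => ε (2 + k)) ∧ ∀ k : ℕ, X (1 + k) =ᵐ[P] Y k := by
  obtain ⟨X', h1, h2⟩ := hX.exists_adapted hρ
  refine ⟨fun k => past ε (1 + k), fun k => X' (1 + k), ⟨?_, ?_, ?_, ?_, ?_⟩, fun k => h2 _⟩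
  · exact fun k l hkl => past_mono ε (by simpa using hkl)
  · exact fun k => hX.past_le _
  · exact fun k => (h1 _).measurable
  · exact fun k => measurable_past ε (by push_cast; omega)
  · exact fun k => hX.indep_past_noise (by omega)

theorem empNoise_succ_ae_eq (hX : IsFAR1 P ρ X ε) {Y : ℕ → Ω → H}
    (hY : ∀ k : ℕ, X (1 + k) =ᵐ[P] Y k) : ∀ᵐ ω ∂P, ∀ n : ℕ,
      empNoise ρ (fun i => X i ω) (n + 1)
        = (n : ℝ)⁻¹ • ∑ k ∈ Finset.range n, tensor (Y k ω) (ε (2 + k) ω) := by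
  have h1 : ∀ᵐ ω ∂P, ∀ k : ℕ, X (1 + k) ω = Y k ω := ae_all_iff.2 hY
  have h2 : ∀ᵐ ω ∂P, ∀ k : ℕ, X (2 + k) ω = ρ (X (2 + k - 1) ω) + ε (2 + k) ω :=
    ae_all_iff.2 fun k => hX.recursion _
  filter_upwards [h1, h2] with ω h3 h4 n
  rw [empNoise, Finset.sum_Ico_eq_sum_range]
  congr 1
  · push_cast; ring
  · refine Finset.sum_congr (by simp) fun k _ => ?_
    have h5 : (((1 + k : ℕ) : ℤ)) = 1 + k := by push_cast; ring
    have h6 : (1 + k : ℤ) + 1 = 2 + k := by ring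
    have h7 : (2 + k : ℤ) - 1 = 1 + k := by ring
    rw [h5, h6, h4 k, h7, add_sub_cancel_left, h3]

/-- The cross terms vanish, so the expected squared Hilbert-Schmidt norm of √(n-1) S_n is at most
𝔼‖X_0‖² 𝔼‖ε_0‖² for every n; Markov's inequality concludes. -/
theorem bddInProb_empNoise (hX : IsFAR1 P ρ X ε) (hL : ∀ n, MemLp (X n) 2 P) (hρ : ‖ρ‖ < 1)
    (hε : MemLp (ε 0) 2 P) :
    BddInProb P fun n ω => √((n : ℝ) - 1) * ‖empNoise ρ (fun i => X i ω) n‖ := by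
  obtain ⟨F, Y, hF, hY⟩ := hX.exists_isPredictableNoise hρ
  have hYL : ∀ k, MemLp (Y k) 2 P := fun k => (hL _).ae_eq (hY k)
  have hηL : ∀ k : ℕ, MemLp (ε (2 + k)) 2 P := fun k => (hX.identDistrib_noise _).memLp_iff.2 hε
  have hη0 : ∀ k : ℕ, ∫ ω, ε (2 + k) ω ∂P = 0 := fun k =>
    (hX.identDistrib_noise _).integral_eq.trans hX.integral_noise
  set HS : ℕ → Ω → ℝ := fun n ω => ∑ k ∈ Finset.range n, ∑ l ∈ Finset.range n,
    inner ℝ (Y k ω) (Y l ω) * inner ℝ (ε (2 + k) ω) (ε (2 + l) ω) with hHS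
  have hHSnn : ∀ n ω, 0 ≤ HS n ω := fun n ω => (sq_nonneg _).trans
    (norm_sum_tensor_sq_le (Finset.range n) (fun k => Y k ω) (fun k : ℕ => ε (2 + k) ω))
  have hHSi := hF.integrable_and_integral_hilbertSchmidt hYL hηL hη0
  refine bddInProb_of_sq (BddInProb.mono (g := fun n ω => ((n - 1 : ℕ) : ℝ)⁻¹ * HS (n - 1) ω)
    (bddInProb_of_integral_le (C := (∫ ω, ‖X 0 ω‖ ^ 2 ∂P) * ∫ ω, ‖ε 0 ω‖ ^ 2 ∂P)
      (fun n => (hHSi (n - 1)).1.const_mul _)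
      (fun n ω => mul_nonneg (by positivity) (hHSnn _ _)) (Eventually.of_forall fun n => ?_)) ?_)
  · rw [integral_const_mul, (hHSi (n - 1)).2]
    have h1 : ∀ k ∈ Finset.range (n - 1), (∫ ω, ‖Y k ω‖ ^ 2 ∂P) * ∫ ω, ‖ε (2 + k) ω‖ ^ 2 ∂P
        = (∫ ω, ‖X 0 ω‖ ^ 2 ∂P) * ∫ ω, ‖ε 0 ω‖ ^ 2 ∂P := fun k _ => by
      have h2 : ∫ ω, ‖Y k ω‖ ^ 2 ∂P = ∫ ω, ‖X (1 + k) ω‖ ^ 2 ∂P := by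
        refine integral_congr_ae ?_
        filter_upwards [hY k] with ω hω
        rw [hω]
      have h3 : ∫ ω, ‖ε (2 + k) ω‖ ^ 2 ∂P = ∫ ω, ‖ε 0 ω‖ ^ 2 ∂P :=
        ((hX.identDistrib_noise (2 + k)).comp (u := fun y => ‖y‖ ^ 2) (by fun_prop)).integral_eq
      rw [h2, h3, hX.integral_comp_process (f := fun y => ‖y‖ ^ 2) (by fun_prop)]
    rw [Finset.sum_congr rfl h1, Finset.sum_const, Finset.card_range, nsmul_eq_mul, ← mul_assoc]
    refine mul_le_of_le_one_left ?_ (inv_mul_le_one)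
    exact mul_nonneg (integral_nonneg fun _ => sq_nonneg _) (integral_nonneg fun _ => sq_nonneg _)
  · filter_upwards [eventually_ge_atTop 1] with n hn
    obtain ⟨N, rfl⟩ := Nat.exists_eq_add_of_le' hn
    filter_upwards [hX.empNoise_succ_ae_eq hY] with ω hω
    have h1 := norm_sum_tensor_sq_le (Finset.range N) (fun k => Y k ω) (fun k : ℕ => ε (2 + k) ω)
    rw [hω N, mul_pow, norm_smul, mul_pow, Nat.add_sub_cancel]
    have h2 : (((N + 1 : ℕ) : ℝ) - 1) = N := by push_cast; ring
    rw [h2, Real.sq_sqrt (Nat.cast_nonneg N), norm_inv, Real.norm_natCast, ← mul_assoc]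
    have h3 : (N : ℝ) * ((N : ℝ)⁻¹) ^ 2 = (N : ℝ)⁻¹ := by
      rcases eq_or_ne (N : ℝ) 0 with h0 | h0
      · simp [h0]
      · field_simp
    rw [h3]
    exact mul_le_mul_of_nonneg_left h1 (by positivity)

theorem smallInProb_empCov (hX : IsFAR1 P ρ X ε) (hL : ∀ n, MemLp (X n) 2 P) (hρ : ‖ρ‖ < 1)
    (h : H) :
    SmallInProb P fun n ω => ‖empCov (fun i => X i ω) n h - covOp P X h‖ := by
  refine SmallInProb.mono (smallInProb_of_tendsto_integral (fun n => ?_)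
    (fun n ω => norm_nonneg _) (hX.tendsto_integral_average hL hρ h)) ?_
  · exact ((integrable_finsetSum _ fun k _ => (integrable_inner_smul_self (hL _) h).sub
      (integrable_const _)).smul _).norm
  · filter_upwards [eventually_gt_atTop 0] with n hn
    refine Eventually.of_forall fun ω => le_of_eq ?_
    have hn' : (n : ℝ) ≠ 0 := by positivity
    rw [empCov_apply, hX.covOp_apply hL, Finset.sum_sub_distrib, smul_sub, Finset.sum_const,
      Finset.card_range, ← Nat.cast_smul_eq_nsmul ℝ, smul_smul, inv_mul_cancel₀ hn', one_smul,
      ← Finset.Ico_succ_right_eq_Icc, Finset.sum_Ico_eq_sum_range]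
    simp

theorem bddInProb_empTrace (hX : IsFAR1 P ρ X ε) (hL : ∀ n, MemLp (X n) 2 P) :
    BddInProb P fun n ω => empTrace (fun i => X i ω) n := by
  have hi : ∀ n, Integrable (fun ω => ‖X n ω‖ ^ 2) P := fun n =>
    (hL n).integrable_norm_pow two_ne_zero
  refine bddInProb_of_integral_le (C := ∫ ω, ‖X 0 ω‖ ^ 2 ∂P)
    (fun n => by
      simp only [empTrace]
      exact (integrable_finsetSum _ fun (k : ℕ) _ => hi k).const_mul _)
    (fun n ω => empTrace_nonneg _ n) (Eventually.of_forall fun n => ?_)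
  simp only [empTrace]
  rw [integral_const_mul, integral_finsetSum _ fun (k : ℕ) _ => hi k, Finset.sum_congr rfl
    fun (k : ℕ) _ => hX.integral_comp_process (f := fun y => ‖y‖ ^ 2) (by fun_prop) (k : ℤ),
    Finset.sum_const,
    Nat.card_Icc, Nat.add_sub_cancel, nsmul_eq_mul, ← mul_assoc]
  exact mul_le_of_le_one_left (integral_nonneg fun _ => sq_nonneg _) inv_mul_le_one

theorem bddInProb_norm_sq (hX : IsFAR1 P ρ X ε) (hL : ∀ n, MemLp (X n) 2 P) :
    BddInProb P fun (n : ℕ) ω => ‖X n ω‖ ^ 2 :=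
  bddInProb_of_integral_le (C := ∫ ω, ‖X 0 ω‖ ^ 2 ∂P)
    (fun n => (hL n).integrable_norm_pow two_ne_zero) (fun n ω => sq_nonneg _)
    (Eventually.of_forall fun n =>
      (hX.integral_comp_process (f := fun y => ‖y‖ ^ 2) (by fun_prop) (n : ℤ)).le)

/-- The central limit theorem for the coordinates of the noise operator. -/
theorem tendsto_integral_cexp_empNoise (hX : IsFAR1 P ρ X ε) (hL : ∀ n, MemLp (X n) 2 P)
    (hρ : ‖ρ‖ < 1) (hε : MemLp (ε 0) 2 P) (a : H) {f : H} (hf : ∫ ω, inner ℝ (ε 0 ω) f ^ 2 ∂P = 1)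
    (t : ℝ) :
    Tendsto (fun n : ℕ => ∫ ω, Complex.exp
        ((t * (√((n : ℝ) - 1) * inner ℝ (empNoise ρ (fun i => X i ω) n a) f) : ℝ) * Complex.I) ∂P)
      atTop (𝓝 (Real.exp (-(t ^ 2 * inner ℝ (covOp P X a) a / 2)) : ℝ)) := by
  obtain ⟨F, Y, hF, hY⟩ := hX.exists_isPredictableNoise hρ
  have hYL : ∀ k, MemLp (Y k) 2 P := fun k => (hL _).ae_eq (hY k)
  have hma : Measurable fun y : H => inner ℝ y a := by fun_prop
  have hmf : Measurable fun y : H => inner ℝ y f := by fun_prop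
  have hYid : ∀ k, IdentDistrib (Y k) (Y 0) P P := fun k =>
    ((IdentDistrib.of_ae_eq (hF.measurable_left k).aemeasurable (hY k).symm).trans
      (hX.identDistrib_process _)).trans ((hX.identDistrib_process _).symm.trans
      (IdentDistrib.of_ae_eq (hX.measurable_process _).aemeasurable (hY 0)))
  have hηid : ∀ n, IdentDistrib (fun ω => inner ℝ (ε n ω) f) (fun ω => inner ℝ (ε 0 ω) f) P P :=
    fun n => (hX.identDistrib_noise n).comp hmf
  have h0 : ∫ ω, inner ℝ (ε 0 ω) f ∂P = 0 := by
    have h1 := integral_inner (𝕜 := ℝ) (hε.integrable (by norm_num)) f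
    rw [hX.integral_noise, inner_zero_right] at h1
    simpa only [real_inner_comm] using h1
  have hYae : ∀ᵐ ω ∂P, ∀ k : ℕ, X (1 + k) ω = Y k ω := ae_all_iff.2 hY
  have hlln : SmallInProb P fun n ω => |(n : ℝ)⁻¹ * ∑ k ∈ Finset.range n, inner ℝ (Y k ω) a ^ 2
      - inner ℝ (covOp P X a) a| := by
    refine SmallInProb.mono ((hX.smallInProb_empCov hL hρ a).const_mul (norm_nonneg a))
      (Eventually.of_forall fun n => ?_)
    filter_upwards [hYae] with ω hω
    have h1 : (n : ℝ)⁻¹ * ∑ k ∈ Finset.range n, inner ℝ (Y k ω) a ^ 2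
        = inner ℝ (empCov (fun i => X i ω) n a) a := by
      rw [empCov_apply, inner_smul_left, sum_inner, ← Finset.Ico_succ_right_eq_Icc,
        Finset.sum_Ico_eq_sum_range]
      simp only [conj_trivial]
      congr 1
      refine Finset.sum_congr (by simp) fun k _ => ?_
      push_cast
      rw [inner_smul_left, hω, pow_two]
      simp
    rw [h1, ← inner_sub_left, mul_comm]
    exact abs_real_inner_le_norm _ _
  have hclt := tendsto_integral_cexp (hF.comp hma hmf) (fun k => (hYid k).comp hma)
    (fun k => (hηid _).trans (hηid _).symm) ((hYL 0).inner_const a)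
    ((hηid _).integral_eq.trans h0)
    ((((hηid _).comp (measurable_id.pow_const 2)).integral_eq).trans hf)
    (hX.inner_covOp_self_nonneg hL a) hlln t
  -- A sample of size n + 1 yields n noise terms, so the central limit theorem at n is read at n +
  -- 1.
  rw [← tendsto_add_atTop_iff_nat 1]
  refine hclt.congr fun n => integral_congr_ae ?_
  filter_upwards [hX.empNoise_succ_ae_eq hY] with ω hω
  have h2 : (((n + 1 : ℕ) : ℝ) - 1) = n := by push_cast; ring
  have h3 : t / √n = t * (√n * (n : ℝ)⁻¹) := by
    rw [div_eq_mul_inv, ← div_eq_mul_inv, ← div_eq_mul_inv, Real.sqrt_div_self', mul_one_div]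
  rw [hω n, h2, h3, smul_apply, sum_apply, inner_smul_left, sum_inner]
  simp only [tensor_apply, inner_smul_left, conj_trivial]
  congr 3
  ring

variable {k : ℕ → ℕ} {lam : ℕ → Ω → ℕ → ℝ} {e : ℕ → Ω → ℕ → H}

theorem smallInProb_eigenvalue (hX : IsFAR1 P ρ X ε) (hL : ∀ n, MemLp (X n) 2 P)
    (hk : Tendsto k atTop atTop)
    (hspec : ∀ n ω, IsSpectralDecomp (empCov (fun i => X i ω) n) (lam n ω) (e n ω)) :
    SmallInProb P fun n ω => lam n ω (k n) := by
  have h1 : Tendsto (fun n => ((k n : ℝ))⁻¹) atTop (𝓝 0) :=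
    tendsto_inv_atTop_zero.comp (tendsto_natCast_atTop_atTop.comp hk)
  refine ((hX.bddInProb_empTrace hL).tendsto_mul h1
    (Eventually.of_forall fun n => by positivity)).mono ?_
  filter_upwards [hk.eventually_gt_atTop 0] with n hn
  refine Eventually.of_forall fun ω => ?_
  have hn' : (0 : ℝ) < k n := by exact_mod_cast hn
  rw [← div_eq_inv_mul, le_div_iff₀ hn', mul_comm]
  exact mul_eigenvalue_le (hspec n ω) (k n)

/-- The empirical spectral projections converge strongly to the identity, in probability. -/
theorem smallInProb_sub_proj (hX : IsFAR1 P ρ X ε) (hL : ∀ n, MemLp (X n) 2 P) (hρ : ‖ρ‖ < 1)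
    (hker : ∀ x : H, covOp P X x = 0 → x = 0) (hk : Tendsto k atTop atTop)
    (hspec : ∀ n ω, IsSpectralDecomp (empCov (fun i => X i ω) n) (lam n ω) (e n ω)) (x : H) :
    SmallInProb P fun n ω =>
      ‖x - truncInv (lam n ω) (e n ω) (k n) (empCov (fun i => X i ω) n x)‖ := by
  intro δ hδ η hη
  -- The distance to Γ h is doubled by `norm_sub_proj_le`, so δ/4 leaves δ/2 for the random terms.
  obtain ⟨h, hh⟩ := (hX.denseRange_covOp hL hker).exists_dist_lt x (show 0 < δ / 4 by positivity)
  have h1 : SmallInProb P fun n ω => 2 * ‖empCov (fun i => X i ω) n h - covOp P X h‖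
      + ‖h‖ * lam n ω (k n) :=
    ((hX.smallInProb_empCov hL hρ h).const_mul zero_le_two).add
      ((hX.smallInProb_eigenvalue hL hk hspec).const_mul (norm_nonneg h))
  filter_upwards [h1 (δ / 2) (by positivity) η hη] with n hn
  refine (measure_mono fun ω hω => ?_).trans hn
  simp only [Set.mem_ofPred_eq] at hω ⊢
  have h2 := norm_sub_proj_le (hspec n ω) (k n) x h
  have h3 : ‖x - empCov (fun i => X i ω) n h‖
      ≤ ‖x - covOp P X h‖ + ‖empCov (fun i => X i ω) n h - covOp P X h‖ := by
    rw [norm_sub_rev (empCov _ n h)]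
    exact norm_sub_le_norm_sub_add_norm_sub _ _ _
  rw [dist_eq_norm] at hh
  linarith

end IsFAR1

end Asymptotics

/-! ### The two regimes of the normalization and identification of the limit. -/

section Limit

set_option linter.unusedSectionVars false

theorem norm_smul_error {H : Type*} [NormedAddCommGroup H] [InnerProductSpace ℝ H] {ρ : Compacts H}
    {a : ℝ} (ha : 0 ≤ a) (x : ℤ → H) (n k : ℕ) (lam : ℕ → ℝ) (e : ℕ → H) :
    ‖a • error ρ x n k lam e‖ = a * ‖estimator x n k lam e - (ρ : H →L[ℝ] H)‖ := by
  have h1 : ‖a • error ρ x n k lam e‖ = ‖a • (estimator x n k lam e - (ρ : H →L[ℝ] H))‖ := rfl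
  rw [h1, norm_smul, Real.norm_of_nonneg ha]

/-- Uses |e^{iz} - 1| ≤ |z| off the exceptional event and ≤ 2 on it. -/
theorem norm_integral_cexp_sub_one_le {Ω : Type*} [MeasurableSpace Ω] {P : Measure Ω}
    [IsProbabilityMeasure P] {z : Ω → ℝ} (hz : Measurable z) {κ p : ℝ} (hκ : 0 ≤ κ) (hp0 : 0 ≤ p)
    (hp : P {ω | κ < |z ω|} ≤ ENNReal.ofReal p) :
    ‖∫ ω, Complex.exp (z ω * Complex.I) ∂P - 1‖ ≤ κ + 2 * p := by
  set bad : Set Ω := {ω | κ < |z ω|}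
  have hbad : MeasurableSet bad :=
    measurableSet_lt measurable_const (continuous_abs.measurable.comp hz)
  have hi : Integrable (fun ω => Complex.exp (z ω * Complex.I)) P :=
    Integrable.of_bound (C := 1) (Complex.measurable_exp.comp
      ((Complex.measurable_ofReal.comp hz).mul_const Complex.I)).aestronglyMeasurable
      (Eventually.of_forall fun ω => by rw [Complex.norm_exp_ofReal_mul_I])
  have h1 : (1 : ℂ) = ∫ _, (1 : ℂ) ∂P := by simp
  rw [h1, ← integral_sub hi (integrable_const _)]
  have h2 : Integrable (fun ω => κ + bad.indicator (fun _ => (2 : ℝ)) ω) P :=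
    (integrable_const _).add ((integrable_const _).indicator hbad)
  refine (norm_integral_le_of_norm_le h2 (Eventually.of_forall fun ω => ?_)).trans ?_
  · by_cases hω : ω ∈ bad
    · rw [Set.indicator_of_mem hω]
      have h3 := norm_sub_le (Complex.exp (z ω * Complex.I)) 1
      rw [Complex.norm_exp_ofReal_mul_I, norm_one] at h3
      linarith
    · rw [Set.indicator_of_notMem hω, add_zero, mul_comm]
      refine (Real.norm_exp_I_mul_ofReal_sub_one_le).trans ?_
      exact not_lt.1 hω
  · rw [integral_add (integrable_const _) ((integrable_const _).indicator hbad),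
      integral_indicator_const _ hbad, integral_const]
    simp only [probReal_univ, smul_eq_mul]
    have h4 : P.real bad ≤ p := ENNReal.toReal_le_of_le_ofReal hp0 hp
    linarith

/-- A sequence converging in distribution in a normed space is bounded in probability. -/
theorem bddInProb_of_tendstoInDistribution {Ω E : Type*} [MeasurableSpace Ω] {P : Measure Ω}
    [IsProbabilityMeasure P] [NormedAddCommGroup E] [MeasurableSpace E] [BorelSpace E]
    {T : ℕ → Ω → E} {ν : Measure E} [IsProbabilityMeasure ν]
    (h : TendstoInDistribution T atTop id (fun _ => P) ν) :
    BddInProb P fun n ω => ‖T n ω‖ := by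
  intro η hη
  have h1 : Tendsto (fun M : ℕ => ν {x : E | (M : ℝ) ≤ ‖x‖}) atTop (𝓝 0) := by
    have h2 := tendsto_measure_iInter_atTop (μ := ν) (s := fun M : ℕ => {x : E | (M : ℝ) ≤ ‖x‖})
      (fun M => (measurableSet_le measurable_const measurable_norm).nullMeasurableSet)
      (fun M N hMN x hx => le_trans (Nat.cast_le.2 hMN) (show (N : ℝ) ≤ ‖x‖ from hx))
      ⟨0, measure_ne_top _ _⟩
    have h3 : ⋂ M : ℕ, {x : E | (M : ℝ) ≤ ‖x‖} = ∅ := by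
      refine Set.eq_empty_of_forall_notMem fun x hx => ?_
      obtain ⟨M, hM⟩ := exists_nat_gt ‖x‖
      exact absurd (Set.mem_iInter.1 hx M) (not_le.2 hM)
    rwa [h3, measure_empty] at h2
  obtain ⟨M, hM1, hM0⟩ := ((h1.eventually (gt_mem_nhds (show 0 < ENNReal.ofReal η by
    simpa using hη))).and (eventually_gt_atTop 0)).exists
  have hF : IsClosed {x : E | (M : ℝ) ≤ ‖x‖} := isClosed_le continuous_const continuous_norm
  have h4 := ProbabilityMeasure.limsup_measure_closed_le_of_tendsto h.tendsto hF
  simp only [ProbabilityMeasure.coe_mk, Measure.map_id] at h4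
  refine ⟨M, by exact_mod_cast hM0, ?_⟩
  filter_upwards [eventually_lt_of_limsup_lt (lt_of_le_of_lt h4 hM1)] with n hn
  rw [Measure.map_apply_of_aemeasurable (h.forall_aemeasurable n) hF.measurableSet] at hn
  refine (measure_mono fun ω hω => ?_).trans hn.le
  exact le_of_lt (show (M : ℝ) < ‖T n ω‖ from hω)

/-- Portmanteau bounds the limit measure of an open set by a liminf, so a bound at infinitely many
times is enough. -/
theorem measure_le_of_frequently {Ω E : Type*} [MeasurableSpace Ω] {P : Measure Ω}
    [IsProbabilityMeasure P] [NormedAddCommGroup E] [MeasurableSpace E] [BorelSpace E]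
    {T : ℕ → Ω → E} {ν : Measure E} [IsProbabilityMeasure ν]
    (h : TendstoInDistribution T atTop id (fun _ => P) ν) {G : Set E} (hG : IsOpen G) {b : ENNReal}
    (hb : ∃ᶠ n in atTop, P {ω | T n ω ∈ G} ≤ b) : ν G ≤ b := by
  have h4 := ProbabilityMeasure.le_liminf_measure_open_of_tendsto h.tendsto hG
  simp only [ProbabilityMeasure.coe_mk, Measure.map_id] at h4
  refine h4.trans (liminf_le_of_frequently_le' (hb.mono fun n hn => ?_))
  rw [Measure.map_apply_of_aemeasurable (h.forall_aemeasurable n) hG.measurableSet]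
  exact hn

variable {H : Type*} [NormedAddCommGroup H] [InnerProductSpace ℝ H] [CompleteSpace H]
  [SecondCountableTopology H] [MeasurableSpace H]
  [BorelSpace H] {Ω : Type*} [mΩ : MeasurableSpace Ω] {P : Measure Ω} [IsProbabilityMeasure P]
  {ρ : Compacts H} {X ε : ℤ → Ω → H} {k : ℕ → ℕ} {lam : ℕ → Ω → ℕ → ℝ} {e : ℕ → Ω → ℕ → H}

namespace IsFAR1

theorem measurable_empNoise_apply (hX : IsFAR1 P (ρ : H →L[ℝ] H) X ε) (n : ℕ) (x : H) :
    Measurable fun ω => empNoise (ρ : H →L[ℝ] H) (fun i => X i ω) n x := by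
  simp only [empNoise_apply]
  have hm := hX.measurable_process
  refine Measurable.const_smul (Finset.measurable_fun_sum _ fun j _ => ?_) _
  exact ((hm _).inner_const).smul ((hm _).sub
    ((ρ : H →L[ℝ] H).continuous.measurable.comp (hm _)))

/-- If the error of the estimate is bounded in probability at the rate `√n`, then so is the noise
operator, by a multiple of the norm of the covariance operator. -/
theorem smallInProb_empNoise_sub (hX : IsFAR1 P (ρ : H →L[ℝ] H) X ε) (hL : ∀ n, MemLp (X n) 2 P)
    (hρ : ‖(ρ : H →L[ℝ] H)‖ < 1) (hε : MemLp (ε 0) 2 P)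
    (hker : ∀ x : H, covOp P X x = 0 → x = 0) (hk : Tendsto k atTop atTop)
    (hspec : ∀ n ω, IsSpectralDecomp (empCov (fun i => X i ω) n) (lam n ω) (e n ω))
    {α : ℕ → ℝ} {c : ℝ} (hc : 0 < c) (hα : ∀ᶠ n : ℕ in atTop, c * √((n : ℝ) - 1) ≤ α n)
    (hT : BddInProb P fun n ω => ‖α n • error ρ (fun i => X i ω) n (k n) (lam n ω) (e n ω)‖)
    (x : H) :
    SmallInProb P fun n ω =>
      √((n : ℝ) - 1) * ‖empNoise (ρ : H →L[ℝ] H) (fun i => X i ω) n x‖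
      - c⁻¹ * ‖covOp P X x‖
        * ‖α n • error ρ (fun i => X i ω) n (k n) (lam n ω) (e n ω)‖ := by
  have ha : Tendsto (fun n : ℕ => √((n : ℝ) - 1) * ((n : ℝ) - 1)⁻¹) atTop (𝓝 0) := by
    have h1 : Tendsto (fun n : ℕ => (√((n : ℝ) - 1))⁻¹) atTop (𝓝 0) :=
      tendsto_inv_atTop_zero.comp (Real.tendsto_sqrt_atTop.comp
        (tendsto_atTop_add_const_right _ (-1) tendsto_natCast_atTop_atTop))
    refine h1.congr fun n => ?_
    rw [← div_eq_mul_inv, Real.sqrt_div_self]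
  have hp := ((hX.smallInProb_empCov hL hρ x).add
    ((hX.smallInProb_eigenvalue hL hk hspec).const_mul (norm_nonneg x)))
  have hw := (((hX.bddInProb_empTrace hL).add (hX.bddInProb_norm_sq hL)).const_mul
    (mul_nonneg (norm_nonneg (ρ : H →L[ℝ] H)) (norm_nonneg x))).tendsto_mul ha (by
      filter_upwards [eventually_ge_atTop 1] with n hn
      have : (1 : ℝ) ≤ n := by exact_mod_cast hn
      exact mul_nonneg (Real.sqrt_nonneg _) (inv_nonneg.2 (by linarith)))
  have hq := (hX.bddInProb_empNoise hL hρ hε).mul_small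
    (hX.smallInProb_sub_proj hL hρ hker hk hspec x) (fun n ω => by positivity)
  have hTp := ((hT.const_mul (inv_nonneg.2 hc.le)).mul_small hp (fun n ω => by positivity))
  refine ((hTp.add hw).add hq).mono ?_
  filter_upwards [eventually_ge_atTop 2, hα] with n hn hαn
  refine Eventually.of_forall fun ω => ?_
  have h1 := norm_empNoise_sub_le (ρ : H →L[ℝ] H) hn (hspec n ω) (covOp P X) (k := k n) x
  have hn' : (2 : ℝ) ≤ n := by exact_mod_cast hn
  set E := estimator (fun i => X i ω) n (k n) (lam n ω) (e n ω) - (ρ : H →L[ℝ] H) with hE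
  set S := empNoise (ρ : H →L[ℝ] H) (fun i => X i ω) n
  set r := √((n : ℝ) - 1) with hr
  have hr0 : 0 < r := Real.sqrt_pos.2 (by linarith)
  have hαpos : 0 < α n := lt_of_lt_of_le (mul_pos hc hr0) hαn
  have hEn : ‖α n • error ρ (fun i => X i ω) n (k n) (lam n ω) (e n ω)‖ = α n * ‖E‖ := by
    exact norm_smul_error hαpos.le _ _ _ _ _
  rw [hEn]
  have hrE : r * ‖E‖ ≤ c⁻¹ * (α n * ‖E‖) := by
    rw [← mul_assoc]
    refine mul_le_mul_of_nonneg_right ?_ (norm_nonneg _)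
    rwa [← div_eq_inv_mul, le_div_iff₀ hc, mul_comm]
  have h2 : ‖S x‖ ≤ ‖S x - E (covOp P X x)‖ + ‖E‖ * ‖covOp P X x‖ := by
    have h3 := norm_le_norm_sub_add (S x) (E (covOp P X x))
    linarith [E.le_opNorm (covOp P X x)]
  set p := ‖empCov (fun i => X i ω) n x - covOp P X x‖ + ‖x‖ * lam n ω (k n) with hp'
  have hp0 : 0 ≤ p := add_nonneg (norm_nonneg _) (mul_nonneg (norm_nonneg _) ((hspec n ω).nonneg _))
  rw [mul_comm (lam n ω (k n)), ← hp'] at h1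
  have h4 := mul_le_mul_of_nonneg_left (h2.trans (add_le_add_left h1 _)) hr0.le
  have h5 := mul_le_mul_of_nonneg_right hrE (add_nonneg hp0 (norm_nonneg (covOp P X x)))
  linarith

/-- At such a rate √n ‖S_n x‖ would be of order ‖Γ x‖, too small for the Gaussian limit along a
direction where ‖Γ x‖ ≪ √⟪Γ x, x⟫. -/
theorem not_eventually_mul_sqrt_le (hX : IsFAR1 P (ρ : H →L[ℝ] H) X ε)
    (hL : ∀ n, MemLp (X n) 2 P)
    (hρ : ‖(ρ : H →L[ℝ] H)‖ < 1) (hε : MemLp (ε 0) 2 P)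
    (hker : ∀ x : H, covOp P X x = 0 → x = 0) (hk : Tendsto k atTop atTop)
    (hspec : ∀ n ω, IsSpectralDecomp (empCov (fun i => X i ω) n) (lam n ω) (e n ω)) {α : ℕ → ℝ}
    (hT : BddInProb P fun n ω => ‖α n • error ρ (fun i => X i ω) n (k n) (lam n ω) (e n ω)‖)
    {c : ℝ} (hc : 0 < c) : ¬ ∀ᶠ n : ℕ in atTop, c * √((n : ℝ) - 1) ≤ α n := by
  intro hα
  obtain ⟨ω₀⟩ : Nonempty Ω := P.nonempty_of_neZero
  -- Infinite dimension enters through an infinite orthonormal sequence; the empirical eigenvectors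
  -- at any n and ω provide one.
  have he := (hspec 0 ω₀).orthonormal
  have : Nontrivial H := ⟨⟨e 0 ω₀ 0, 0, he.ne_zero 0⟩⟩
  obtain ⟨f, hf⟩ := hX.exists_integral_inner_noise_eq_one hL hε hρ hker
  -- M, hence K, is fixed before x is chosen; this uniformity in x is what the contradiction rests
  -- on.
  obtain ⟨M, hM, hTM⟩ := hT (1 / 16) (by norm_num)
  set K := c⁻¹ * M * ‖f‖ with hK
  have hK0 : 0 ≤ K := by positivity
  obtain ⟨x, hx0, hx⟩ := hX.exists_norm_covOp_sq_le hL hker he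
    (show 0 < (1 / (8 * (K + 1))) ^ 2 by positivity)
  set v := inner ℝ (covOp P X x) x with hv
  have hv0 : 0 < √v := Real.sqrt_pos.2 hx0
  have hΓ : ‖covOp P X x‖ ≤ 1 / (8 * (K + 1)) * √v := by
    refine le_of_sq_le_sq ?_ (by positivity)
    rwa [mul_pow, Real.sq_sqrt hx0.le]
  have hsmall := hX.smallInProb_empNoise_sub hL hρ hε hker hk hspec hc hα hT x
    (√v / (8 * (‖f‖ + 1))) (by positivity) (1 / 16) (by norm_num)
  -- The frequency 2/√v normalizes the limit to e⁻², at distance more than 3/4 from 1, while the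
  -- bound below keeps the integrals within 1/2 + 2 · (1/8) = 3/4 of 1.
  have hcf := hX.tendsto_integral_cexp_empNoise hL hρ hε x hf (2 / √v)
  have hlim : (2 / √v) ^ 2 * v / 2 = 2 := by
    rw [div_pow, Real.sq_sqrt hx0.le]
    field_simp
  rw [← hv, hlim] at hcf
  have hbound : ∀ᶠ n : ℕ in atTop, ‖∫ ω, Complex.exp ((2 / √v * (√((n : ℝ) - 1)
      * inner ℝ (empNoise (ρ : H →L[ℝ] H) (fun i => X i ω) n x) f) : ℝ) * Complex.I) ∂P - 1‖
      ≤ 1 / 2 + 2 * (1 / 8) := by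
    filter_upwards [hTM, hsmall] with n h1 h2
    refine norm_integral_cexp_sub_one_le
      ((((hX.measurable_empNoise_apply n x).inner_const).const_mul _).const_mul _)
      (by norm_num) (by norm_num) ?_
    refine measure_le_ofReal_of_subset_union (by norm_num) (fun ω hω => ?_)
      (h1.trans (ENNReal.ofReal_le_ofReal (by norm_num)))
      (h2.trans (ENNReal.ofReal_le_ofReal (by norm_num)))
    by_contra! hcon
    simp only [Set.mem_union, Set.mem_ofPred_eq, not_or, not_lt] at hcon hω
    obtain ⟨h3, h4⟩ := hcon
    set T := ‖α n • error ρ (fun i => X i ω) n (k n) (lam n ω) (e n ω)‖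
    set S := empNoise (ρ : H →L[ℝ] H) (fun i => X i ω) n x
    set r := √((n : ℝ) - 1)
    have hr0 : 0 ≤ r := Real.sqrt_nonneg _
    have h5 : r * ‖S‖ ≤ c⁻¹ * ‖covOp P X x‖ * M + √v / (8 * (‖f‖ + 1)) := by
      have := mul_le_mul_of_nonneg_left h3 (show 0 ≤ c⁻¹ * ‖covOp P X x‖ by positivity)
      linarith
    have h6 : |2 / √v * (r * inner ℝ S f)| ≤ 2 / √v * (r * ‖S‖ * ‖f‖) := by
      rw [abs_mul, abs_mul, abs_of_nonneg (by positivity : 0 ≤ 2 / √v), abs_of_nonneg hr0, mul_assoc r]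
      gcongr
      exact abs_real_inner_le_norm _ _
    have h7 : r * ‖S‖ * ‖f‖ ≤ √v / 4 := by
      have h8 : c⁻¹ * ‖covOp P X x‖ * M * ‖f‖ ≤ √v / 8 := by
        calc c⁻¹ * ‖covOp P X x‖ * M * ‖f‖ = K * ‖covOp P X x‖ := by rw [hK]; ring
          _ ≤ (K + 1) * (1 / (8 * (K + 1)) * √v) := by gcongr; linarith
          _ = √v / 8 := by field_simp
      have h9 : √v / (8 * (‖f‖ + 1)) * ‖f‖ ≤ √v / 8 := by
        calc √v / (8 * (‖f‖ + 1)) * ‖f‖ ≤ √v / (8 * (‖f‖ + 1)) * (‖f‖ + 1) := by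
              gcongr; linarith
          _ = √v / 8 := by field_simp
      have := mul_le_mul_of_nonneg_right h5 (norm_nonneg f)
      linarith
    have h10 : 2 / √v * (r * ‖S‖ * ‖f‖) ≤ 1 / 2 := by
      calc 2 / √v * (r * ‖S‖ * ‖f‖) ≤ 2 / √v * (√v / 4) := by gcongr
        _ = 1 / 2 := by field_simp; norm_num
    linarith
  have h11 := le_of_tendsto (hcf.sub_const 1).norm hbound
  rw [← Complex.ofReal_one, ← Complex.ofReal_sub, Complex.norm_real, Real.norm_eq_abs] at h11
  have h12 : Real.exp (-2) < 1 / 4 := by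
    have h13 : Real.exp (-2) = (Real.exp 1 ^ 2)⁻¹ := by
      rw [← Real.exp_nat_mul, ← Real.exp_neg]; norm_num
    rw [h13, inv_lt_comm₀ (by positivity) (by norm_num)]
    nlinarith [Real.exp_one_gt_d9]
  have := neg_le_of_abs_le h11
  linarith

/-- Along the times when the normalization is small compared to `√n`, the normalized error vanishes
on the range of the covariance operator. -/
theorem measure_norm_apply_covOp_gt (hX : IsFAR1 P (ρ : H →L[ℝ] H) X ε)
    (hL : ∀ n, MemLp (X n) 2 P) (hρ : ‖(ρ : H →L[ℝ] H)‖ < 1) (hε : MemLp (ε 0) 2 P)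
    (hk : Tendsto k atTop atTop)
    (hspec : ∀ n ω, IsSpectralDecomp (empCov (fun i => X i ω) n) (lam n ω) (e n ω)) {α : ℕ → ℝ}
    (hα : Tendsto α atTop atTop)
    (hα' : ∀ c : ℝ, 0 < c → ∃ᶠ n : ℕ in atTop, α n < c * √((n : ℝ) - 1))
    {ν : Measure (Compacts H)} [IsProbabilityMeasure ν]
    (hν : TendstoInDistribution
      (fun n ω => α n • error ρ (fun i => X i ω) n (k n) (lam n ω) (e n ω))
      atTop id (fun _ => P) ν) (x : H) {δ : ℝ} (hδ : 0 < δ) :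
    ν {T : Compacts H | δ < ‖(T : H →L[ℝ] H) (covOp P X x)‖} = 0 := by
  have hG : IsOpen {T : Compacts H | δ < ‖(T : H →L[ℝ] H) (covOp P X x)‖} :=
    isOpen_lt continuous_const
      ((continuous_subtype_val.clm_apply continuous_const).norm)
  have hT : BddInProb P fun n ω =>
      ‖α n • error ρ (fun i => X i ω) n (k n) (lam n ω) (e n ω)‖ :=
    bddInProb_of_tendstoInDistribution hν
  have hTp := hT.mul_small ((hX.smallInProb_empCov hL hρ x).add
    ((hX.smallInProb_eigenvalue hL hk hspec).const_mul (norm_nonneg x)))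
    (fun n ω => norm_nonneg _)
  have hZ := (((hX.bddInProb_empTrace hL).add (hX.bddInProb_norm_sq hL)).const_mul
    (mul_nonneg (norm_nonneg (ρ : H →L[ℝ] H)) (norm_nonneg x))).add
    ((hX.bddInProb_empNoise hL hρ hε).const_mul (show 0 ≤ 3 * ‖x‖ by positivity))
  refine le_antisymm (ENNReal.le_of_forall_pos_le_add fun η hη _ => ?_) zero_le
  rw [zero_add, ← ENNReal.ofReal_coe_nnreal]
  have hη' : (0 : ℝ) < η := hη
  refine measure_le_of_frequently hν hG ?_
  obtain ⟨M, hM, hZM⟩ := hZ (η / 2) (by positivity)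
  have hev := hTp (δ / 2) (by positivity) (η / 2) (by positivity)
  -- At these times α_n/√(n-1) < δ/(2M), so the noise and boundary terms cost at most δ/2; the term
  -- proportional to ‖E‖ takes the other half.
  refine ((hα' (δ / (2 * M)) (by positivity)).and_eventually ((hZM.and hev).and
    ((eventually_ge_atTop 2).and (hα.eventually_gt_atTop 0)))).mono ?_
  rintro n ⟨hαn, ⟨h1, h2⟩, hn, hαpos⟩
  refine measure_le_ofReal_of_subset_union hη' (fun ω hω => ?_) h1 h2
  by_contra! hcon
  simp only [Set.mem_union, Set.mem_ofPred_eq, not_or, not_lt] at hcon hω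
  obtain ⟨h3, h4⟩ := hcon
  have h5 := norm_empNoise_sub_le (ρ : H →L[ℝ] H) hn (hspec n ω) (covOp P X) (k := k n) x
  have hn' : (2 : ℝ) ≤ n := by exact_mod_cast hn
  -- A crude bound on the projection suffices, since here α_n ‖S_n‖ is itself small.
  have hproj : ‖x - truncInv (lam n ω) (e n ω) (k n) (empCov (fun i => X i ω) n x)‖ ≤ 2 * ‖x‖ := by
    have := norm_sub_le x (truncInv (lam n ω) (e n ω) (k n) (empCov (fun i => X i ω) n x))
    linarith [(hspec n ω).norm_truncInv_comp_le (k n) x]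
  set E := estimator (fun i => X i ω) n (k n) (lam n ω) (e n ω) - (ρ : H →L[ℝ] H) with hE
  set S := empNoise (ρ : H →L[ℝ] H) (fun i => X i ω) n
  set r := √((n : ℝ) - 1) with hr
  have hr0 : 0 < r := Real.sqrt_pos.2 (by linarith)
  have hEn : ‖α n • error ρ (fun i => X i ω) n (k n) (lam n ω) (e n ω)‖ = α n * ‖E‖ := by
    exact norm_smul_error hαpos.le _ _ _ _ _
  have hEx : ‖((α n • error ρ (fun i => X i ω) n (k n) (lam n ω) (e n ω) : Compacts H) :
      H →L[ℝ] H) (covOp P X x)‖ = α n * ‖E (covOp P X x)‖ := by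
    have h6 : ((α n • error ρ (fun i => X i ω) n (k n) (lam n ω) (e n ω) : Compacts H) :
      H →L[ℝ] H) (covOp P X x) = α n • E (covOp P X x) := rfl
    rw [h6, norm_smul, Real.norm_of_nonneg hαpos.le]
  rw [hEx] at hω
  rw [hEn] at h4
  set p := ‖empCov (fun i => X i ω) n x - covOp P X x‖ + ‖x‖ * lam n ω (k n) with hp'
  rw [mul_comm (lam n ω (k n)), ← hp'] at h5
  set w := empTrace (fun i => X i ω) n + ‖X n ω‖ ^ 2 with hw
  have hw0 : 0 ≤ w := add_nonneg (empTrace_nonneg _ n) (sq_nonneg _)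
  have hinv : ((n : ℝ) - 1)⁻¹ ≤ r⁻¹ := by
    have h1r : 1 ≤ r := Real.one_le_sqrt.2 (by linarith)
    refine inv_anti₀ hr0 ?_
    have h7 : r ^ 2 = (n : ℝ) - 1 := Real.sq_sqrt (by linarith)
    nlinarith
  have h8 : ‖E (covOp P X x)‖ ≤ ‖S x - E (covOp P X x)‖ + ‖S‖ * ‖x‖ := by
    have h9 := norm_le_norm_sub_add (E (covOp P X x)) (S x)
    rw [norm_sub_rev] at h9
    linarith [S.le_opNorm x]
  have h10 : ‖S‖ * ‖x - truncInv (lam n ω) (e n ω) (k n) (empCov (fun i => X i ω) n x)‖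
      ≤ ‖S‖ * (2 * ‖x‖) := by gcongr
  have h11 : ((n : ℝ) - 1)⁻¹ * (‖(ρ : H →L[ℝ] H)‖ * (w * ‖x‖))
      ≤ r⁻¹ * (‖(ρ : H →L[ℝ] H)‖ * (w * ‖x‖)) := by gcongr
  have h12 : ‖E (covOp P X x)‖ ≤ ‖E‖ * p
      + r⁻¹ * (‖(ρ : H →L[ℝ] H)‖ * ‖x‖ * w + 3 * ‖x‖ * (r * ‖S‖)) := by
    have h13 : r⁻¹ * (3 * ‖x‖ * (r * ‖S‖)) = 3 * ‖x‖ * ‖S‖ := by field_simp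
    linarith
  have h14 : α n * r⁻¹ ≤ δ / (2 * M) := by
    rw [← div_eq_mul_inv, div_le_iff₀ hr0]
    exact hαn.le
  have h15 := mul_le_mul_of_nonneg_left h12 hαpos.le
  have h16 : α n * r⁻¹ * (‖(ρ : H →L[ℝ] H)‖ * ‖x‖ * w + 3 * ‖x‖ * (r * ‖S‖)) ≤ δ / (2 * M) * M := by
    gcongr
  have h17 : δ / (2 * M) * M = δ / 2 := by field_simp
  rw [h17] at h16
  linarith

theorem eq_dirac (hX : IsFAR1 P (ρ : H →L[ℝ] H) X ε)
    (hρ : ‖(ρ : H →L[ℝ] H)‖ < 1) (hε : MemLp (ε 0) 2 P)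
    (hker : ∀ x : H, covOp P X x = 0 → x = 0) (hk : Tendsto k atTop atTop)
    (hspec : ∀ n ω, IsSpectralDecomp (empCov (fun i => X i ω) n) (lam n ω) (e n ω)) {α : ℕ → ℝ}
    (hα : Tendsto α atTop atTop) {ν : Measure (Compacts H)} [IsProbabilityMeasure ν]
    (hν : TendstoInDistribution
      (fun n ω => α n • error ρ (fun i => X i ω) n (k n) (lam n ω) (e n ω))
      atTop id (fun _ => P) ν) : ν = Measure.dirac 0 := by
  have hL := hX.memLp_process hρ hε
  have hα' : ∀ c : ℝ, 0 < c → ∃ᶠ n : ℕ in atTop, α n < c * √((n : ℝ) - 1) := fun c hc => by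
    have h1 := hX.not_eventually_mul_sqrt_le hL hρ hε hker hk hspec
      (bddInProb_of_tendstoInDistribution hν) hc
    simpa only [not_eventually, not_le] using h1
  -- Separability reduces the vanishing of T Γ to countably many null events.
  have h1 : ∀ᵐ T : Compacts H ∂ν, ∀ j m : ℕ,
      ‖(T : H →L[ℝ] H) (covOp P X (TopologicalSpace.denseSeq H j))‖ ≤ 1 / ((m : ℝ) + 1) := by
    refine ae_all_iff.2 fun j => ae_all_iff.2 fun m => ?_
    rw [ae_iff]
    simpa only [not_le] using hX.measure_norm_apply_covOp_gt hL hρ hε hk hspec hα hα' hν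
      (TopologicalSpace.denseSeq H j) (Nat.one_div_pos_of_nat (α := ℝ) (n := m))
  have h2 : ∀ᵐ T ∂ν, T = (0 : Compacts H) := by
    filter_upwards [h1] with T hT
    have h3 : ∀ j, (T : H →L[ℝ] H) (covOp P X (TopologicalSpace.denseSeq H j)) = 0 := fun j =>
      norm_le_zero_iff.1 (ge_of_tendsto' tendsto_one_div_add_atTop_nhds_zero_nat (hT j))
    have h4 : ∀ y, (T : H →L[ℝ] H) (covOp P X y) = 0 := fun y =>
      (TopologicalSpace.denseRange_denseSeq H).induction_on
        (p := fun y => (T : H →L[ℝ] H) (covOp P X y) = 0) y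
        (isClosed_eq (by fun_prop) continuous_const) h3
    have h5 : ∀ y, (T : H →L[ℝ] H) y = 0 := fun y =>
      (hX.denseRange_covOp hL hker).induction_on (p := fun y => (T : H →L[ℝ] H) y = 0) y
        (isClosed_eq (by fun_prop) continuous_const) h4
    exact Subtype.ext (ContinuousLinearMap.ext h5)
  calc ν = ν.map id := Measure.map_id.symm
    _ = ν.map fun _ => 0 := Measure.map_congr h2
    _ = Measure.dirac 0 := by rw [Measure.map_const, measure_univ, one_smul]

end IsFAR1

end Limit

end FAR

theorem theorem1
    {H : Type*} [NormedAddCommGroup H] [InnerProductSpace ℝ H] [CompleteSpace H]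
    [TopologicalSpace.SeparableSpace H] [MeasurableSpace H] [BorelSpace H]
    (hH : ¬ FiniteDimensional ℝ H)
    {Ω : Type*} [MeasurableSpace Ω] (P : Measure Ω) [IsProbabilityMeasure P]
    (ρ : FAR.Compacts H) (X ε : ℤ → Ω → H)
    (hX : FAR.IsFAR1 P (ρ : H →L[ℝ] H) X ε)
    (hker : ∀ x : H, FAR.covOp P X x = 0 → x = 0)
    (hε : MemLp (ε 0) 2 P)
    (hρ : ‖ρ‖ < 1)
    (k : ℕ → ℕ) (hk : Tendsto k atTop atTop)
    (lam : ℕ → Ω → ℕ → ℝ) (e : ℕ → Ω → ℕ → H)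
    (hspec : ∀ n ω, FAR.IsSpectralDecomp (FAR.empCov (fun i => X i ω) n) (lam n ω) (e n ω))
    (α : ℕ → ℝ) (hα : Tendsto α atTop atTop)
    (ν : Measure (FAR.Compacts H)) [IsProbabilityMeasure ν]
    (hν : TendstoInDistribution
      (fun n ω => α n • FAR.error ρ (fun i => X i ω) n (k n) (lam n ω) (e n ω))
      atTop id (fun _ => P) ν) :
    ν = Measure.dirac 0 := by
  have := UniformSpace.secondCountable_of_separable H
  exact FAR.IsFAR1.eq_dirac hX hρ hε hker hk hspec hα hν
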